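/- Let $G$ be a finite group and $\chi$ an irreducible complex character of $G$ of even degree $\chi(1)=2m$ with Frobenius–Schur indicator $o$ (i.e. $\chi$ is not real valued). Let $L=\mathbb{Q}(\chi)$ be the character field and $K=L\cap\mathbb{R}$ its real subfield. Assume that $\chi$ is afforded by an $L$-representation $\rho:G\to \mathrm{GL}(V)$, and let $H:V\times V\to L$ be a non-degenerate $\rho(G)$-invariant $L/K$-Hermitian form, with adjoint involution $\iota_H$ on $\mathrm{End}_L(V)$. Let $\alpha\in\mathrm{Aut}(G)$ satisfy $\alpha^2=1$ and $\chi\circ\alpha=\overline{\chi}$, and assume that the character $\mathrm{Ind}_G^{G:\langle\alpha\rangle}(\chi)$ of the semidirect product $G:\langle\alpha\rangle$ has Frobenius–Schur indicator $+$. Let $$A=\langle \rho(g)+\rho(\alpha(g)) \mid g\in G\rangle_K\subseteq \mathrm{End}_L(V)$$ be the $\alpha$-fixed algebra, a central simple $K$-algebra of degree $2m$ on which $\iota_H$ restricts to an orthogonal involution. The $\alpha$-discriminant of $\chi$ is the discriminant of $\iota_H|_A$, i.e. the square class $(-1)^m N_{\mathrm{red}}(a)\,(K^\times)^2$ for any invertible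 $a\in A$ with $\iota_H(a)=-a$. Then such elements $a$ exist and the $\alpha$-discriminant is a well-defined square class $d\,(K^\times)^2$; and every (non-zero) prime ideal $\wp$ of the ring of integers of $K$ that ramifies in the $\alpha$-discriminant algebra $K[X]/(X^2-d)$ of $\chi$ divides $2|G|$. -/

import Mathlib

open scoped TensorProduct nonZeroDivisors ComplexConjugate Polynomial

noncomputable section

namespace AlphaDisc

/-! ### Ordinary characters and Frobenius-Schur indicators -/

/-- `τ` is a complex representation of `Γ` affording the character `χ`. -/
def Affords {Γ : Type*} [Group Γ] (χ : Γ → ℂ) {n : ℕ}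
    (τ : Representation ℂ Γ (Fin n → ℂ)) : Prop :=
  ∀ g, τ.character g = χ g

/-- `χ` is an irreducible ordinary (complex) character of `Γ`. -/
def IsIrrChar {Γ : Type*} [Group Γ] (χ : Γ → ℂ) : Prop :=
  ∃ (n : ℕ) (τ : Representation ℂ Γ (Fin n → ℂ)), τ.IsIrreducible ∧ Affords χ τ

/-- `χ` takes only real values. -/
def RealValued {Γ : Type*} (χ : Γ → ℂ) : Prop := ∀ g, conj (χ g) = χ g

/-- The bilinear form `B` is invariant under the representation `τ`. -/
def InvariantForm {Γ W : Type*} [Group Γ] [AddCommGroup W] [Module ℂ W]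
    (τ : Representation ℂ Γ W) (B : LinearMap.BilinForm ℂ W) : Prop :=
  ∀ g v w, B (τ g v) (τ g w) = B v w

/-- Frobenius-Schur indicator `+`: `χ` is real valued and a complex representation affording `χ`
carries a non-degenerate invariant quadratic form (given by its symmetric bilinear form). -/
def IndicatorPlus {Γ : Type*} [Group Γ] (χ : Γ → ℂ) : Prop :=
  RealValued χ ∧ ∃ (n : ℕ) (τ : Representation ℂ Γ (Fin n → ℂ)), Affords χ τ ∧
    ∃ B : LinearMap.BilinForm ℂ (Fin n → ℂ), B.IsSymm ∧ B.Nondegenerate ∧ InvariantForm τ B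

/-- `χ` is real valued and a complex representation affording `χ` carries a non-degenerate
invariant symplectic form. (For irreducible `χ` this is Frobenius-Schur indicator `-`.) -/
def IndicatorMinus {Γ : Type*} [Group Γ] (χ : Γ → ℂ) : Prop :=
  RealValued χ ∧ ∃ (n : ℕ) (τ : Representation ℂ Γ (Fin n → ℂ)), Affords χ τ ∧
    ∃ B : LinearMap.BilinForm ℂ (Fin n → ℂ), B.IsAlt ∧ B.Nondegenerate ∧ InvariantForm τ B

/-- Frobenius-Schur indicator `o`: all other cases. -/
def IndicatorO {Γ : Type*} [Group Γ] (χ : Γ → ℂ) : Prop :=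
  ¬ IndicatorPlus χ ∧ ¬ IndicatorMinus χ

/-! ### The extended group and the induced character -/

/-- The semidirect product `G : ⟨α⟩`. -/
abbrev ExtGroup {G : Type*} [Group G] (α : MulAut G) : Type _ :=
  G ⋊[(Subgroup.zpowers α).subtype] (Subgroup.zpowers α)

/-- The character of `G : ⟨α⟩` induced from `χ`:
`x ↦ |G|⁻¹ ∑ y, χ°(y x y⁻¹)`, with `χ°` equal to `χ` on `G` and to `0` off `G`. -/
def inducedChar {G : Type*} [Group G] (χ : G → ℂ) (α : MulAut G) (x : ExtGroup α) : ℂ :=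
  open Classical in
  (Nat.card G : ℂ)⁻¹ * ∑ᶠ y : ExtGroup α,
    if (y * x * y⁻¹).right = 1 then χ (y * x * y⁻¹).left else 0

/-! ### The character field and its real subfield -/

/-- The character field `L = ℚ(χ)`. -/
abbrev charField {G : Type*} (χ : G → ℂ) : IntermediateField ℚ ℂ :=
  IntermediateField.adjoin ℚ (Set.range χ)

/-- The real subfield `K = L⁺ = L ∩ ℝ` of the character field. -/
abbrev realField {G : Type*} (χ : G → ℂ) : Subfield (charField χ) :=
  Complex.ofRealHom.fieldRange.comap (algebraMap (charField χ) ℂ)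

/-! ### Invariant Hermitian forms -/

/-- `H` is a non-degenerate `L/K`-Hermitian form on the `L`-vector space `V`, invariant under the
representation `ρ`, where `L` is a subfield of `ℂ` and conjugation is complex conjugation. -/
structure IsInvariantHermitian {G V : Type*} [Group G] {L : IntermediateField ℚ ℂ}
    [AddCommGroup V] [Module L V] (ρ : Representation L G V) (H : V → V → L) : Prop where
  add_left : ∀ v v' w, H (v + v') w = H v w + H v' w
  smul_left : ∀ (a : L) v w, H (a • v) w = a * H v w
  conj_symm : ∀ v w, (H v w : ℂ) = conj (H w v : ℂ)
  nondegenerate : ∀ v, (∀ w, H v w = 0) → v = 0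
  invariant : ∀ g v w, H (ρ g v) (ρ g w) = H v w

/-- `a` is skew for the adjoint involution `ι_H` of `H`, i.e. `ι_H(a) = -a`; here `ι_H(a)` is
determined by `H (a v) w = H v (ι_H(a) w)`. -/
def IsSkew {L V : Type*} [Field L] [AddCommGroup V] [Module L V] (H : V → V → L)
    (a : Module.End L V) : Prop :=
  ∀ v w, H (a v) w = H v ((-a) w)

/-! ### The fixed algebra -/

section FixedAlgebra

variable {G V L : Type*} [Group G] [Field L] (K : Subfield L)
  [AddCommGroup V] [Module L V] (ρ : Representation L G V) (α : MulAut G)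

/-- The `K`-span of the endomorphisms `ρ(g) + ρ(α(g))`. -/
def fixedSpan : Submodule K (Module.End L V) :=
  Submodule.span K (Set.range fun g => ρ g + ρ (α g))

theorem one_mem_fixedSpan [CharZero L] : (1 : Module.End L V) ∈ fixedSpan K ρ α := by
  have h : (2 : K)⁻¹ • (ρ 1 + ρ (α 1)) ∈ fixedSpan K ρ α :=
    Submodule.smul_mem _ _ (Submodule.subset_span ⟨1, rfl⟩)
  have h2 : (2 : K) ≠ 0 := two_ne_zero
  have e : ρ 1 + ρ (α 1) = (2 : K) • (1 : Module.End L V) := by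
    rw [map_one α, map_one ρ, two_smul]
  rwa [e, smul_smul, inv_mul_cancel₀ h2, one_smul] at h

theorem mul_mem_fixedSpan (hα : α ^ 2 = 1) {x y : Module.End L V}
    (hx : x ∈ fixedSpan K ρ α) (hy : y ∈ fixedSpan K ρ α) : x * y ∈ fixedSpan K ρ α := by
  have hαα : ∀ g, α (α g) = g := fun g => by
    have := congrArg (fun β : MulAut G => β g) hα
    simpa [pow_two] using this
  induction hx using Submodule.span_induction with
  | zero => simp
  | add a b _ _ ha hb => rw [add_mul]; exact Submodule.add_mem _ ha hb
  | smul c a _ ha => rw [smul_mul_assoc]; exact Submodule.smul_mem _ _ ha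
  | mem a ha =>
    obtain ⟨g, rfl⟩ := ha
    induction hy using Submodule.span_induction with
    | zero => simp
    | add a b _ _ ha hb => rw [mul_add]; exact Submodule.add_mem _ ha hb
    | smul c a _ ha => rw [mul_smul_comm]; exact Submodule.smul_mem _ _ ha
    | mem b hb =>
      obtain ⟨h, rfl⟩ := hb
      have e : (ρ g + ρ (α g)) * (ρ h + ρ (α h)) =
          (ρ (g * h) + ρ (α (g * h))) + (ρ (g * α h) + ρ (α (g * α h))) := by
        simp only [map_mul, hαα]
        noncomm_ring
      exact e ▸ Submodule.add_mem _ (Submodule.subset_span ⟨_, rfl⟩)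
        (Submodule.subset_span ⟨_, rfl⟩)

/-- The `α`-fixed algebra `Fix_α(ρ) = ⟨ρ(g) + ρ(α(g)) ∣ g ∈ G⟩_K`, a `K`-subalgebra of
`End_L(V)`. -/
def fixedAlgebra [CharZero L] (hα : α ^ 2 = 1) : Subalgebra K (Module.End L V) :=
  (fixedSpan K ρ α).toSubalgebra (one_mem_fixedSpan K ρ α)
    (fun _ _ hx hy => mul_mem_fixedSpan K ρ α hα hx hy)

end FixedAlgebra

/-! ### Reduced norms and discriminants of involutions -/

/-- `c` is the reduced norm of the element `a` of the central simple `K`-algebra `A`: over a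
splitting field `E` of `A`, the matrix corresponding to `1 ⊗ a` has determinant `c`. -/
def IsReducedNorm {K : Type} {A : Type*} [Field K] [Ring A] [Algebra K A] (a : A) (c : K) :
    Prop :=
  ∃ (E : Type) (_ : Field E) (_ : Algebra K E) (n : ℕ)
    (f : (E ⊗[K] A) ≃ₐ[E] Matrix (Fin n) (Fin n) E),
    (f (1 ⊗ₜ[K] a)).det = algebraMap K E c

/-- The square class `(-1)^m N_red(a) (Kˣ)²`, as a subset of `Kˣ`, for `a` ranging over the
invertible skew elements (the set of skew elements being `S`) of a central simple `K`-algebra `A`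
of degree `2m`. -/
def discClass (K : Type) {A : Type*} [Field K] [Ring A] [Algebra K A] (S : Set A) : Set Kˣ :=
  {d | ∃ (m : ℕ) (a : A) (c : K) (s : Kˣ), Module.finrank K A = (2 * m) ^ 2 ∧
    a ∈ S ∧ IsUnit a ∧ IsReducedNorm a c ∧ (d : K) = (-1) ^ m * c * (s : K) ^ 2}

/-- The `α`-discriminant of the character `χ` afforded by `ρ`: the discriminant of the restriction
of the adjoint involution of `H` to the `α`-fixed algebra, as a subset of `Kˣ`. -/
def alphaDisc {G V : Type*} [Group G] (χ : G → ℂ) [AddCommGroup V] [Module (charField χ) V]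
    (ρ : Representation (charField χ) G V) (H : V → V → charField χ)
    (α : MulAut G) (hα : α ^ 2 = 1) : Set (realField χ)ˣ :=
  discClass (realField χ)
    {a : fixedAlgebra (realField χ) ρ α hα | IsSkew H (a : Module.End (charField χ) V)}

/-! ### Quadratic étale algebras and ramification -/

/-- The étale algebra `K[X]/(X² - d)`. -/
abbrev quadAlgebra {K : Type*} [Field K] (d : K) : Type _ :=
  AdjoinRoot (Polynomial.X ^ 2 - Polynomial.C d : K[X])

/-- The prime ideal `v` of the ring of integers of `K` ramifies in the étale `K`-algebra `E`:
the integral closure of `𝓞 K` in `E` is not unramified over `v`. -/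
def RamifiesIn {K : Type*} [Field K] (v : IsDedekindDomain.HeightOneSpectrum
    (NumberField.RingOfIntegers K)) (E : Type*) [CommRing E] [Algebra K E] : Prop :=
  ¬ Algebra.IsUnramifiedIn
    (integralClosure (NumberField.RingOfIntegers K) E) v.asIdeal

end AlphaDisc

end

/-!
There is a non-degenerate bilinear form `B` on `V` with `B (ρ g v) (ρ (α g) w) = B v w`, unique up
to scalars by Schur's lemma, and symmetric because the induced character has indicator `+`, which
gives `∑ g, χ (g * α g) = |G|`. On the `α`-fixed algebra `A` the adjoint involutions of `B` and `H`
agree, and `L ⊗[K] A = End_L(V)`, so that the reduced norm on `A` is the determinant. If `a` is skew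
for `B` and `S` is a Gram matrix of `B`, then `S * a` is skew-symmetric, so `det S * det a` is a
square in `L`. That the class is well defined in `K` comes from the Pfaffian: the characteristic
polynomial of a quotient of two skew elements is the square of a polynomial over `K`.

At a prime `v ∤ 2|G|` choose `w | v` in `L`, which is unramified since `L` lies in the cyclotomic
field of conductor `|G|`. A `G`-stable lattice over the local ring at `w` spans its full
endomorphism ring, so `S` is unimodular up to a scalar, and `w (det S)` is even since the dimension
is. Hence `v d` is even and `v` is unramified in `K[X]/(X² - d)`.
-/

noncomputable section

namespace AlphaDisc

section SkewMatrices

open Matrix Polynomial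

variable {R F m n : Type*} [CommRing R] [Field F]

theorem apply_eq_neg_of_skew {M : Matrix n n R} (hM : Mᵀ = -M) (i j : n) : M i j = -M j i :=
  congrFun (congrFun hM j) i

theorem apply_self_eq_zero_of_skew [NeZero (2 : F)] {M : Matrix n n F} (hM : Mᵀ = -M) (i : n) :
    M i i = 0 := by
  have h : (2 : F) * M i i = 0 := by linear_combination apply_eq_neg_of_skew hM i i
  exact (mul_eq_zero.1 h).resolve_left two_ne_zero

variable [Fintype m] [DecidableEq m] [Fintype n] [DecidableEq n]

theorem exists_skew_schur_complement [NeZero (2 : F)] {M : Matrix (Fin 2 ⊕ m) (Fin 2 ⊕ m) F}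
    (hM : Mᵀ = -M) (h : M (.inl 0) (.inl 1) ≠ 0) :
    ∃ N : Matrix m m F, Nᵀ = -N ∧ M.det = M (.inl 0) (.inl 1) ^ 2 * N.det := by
  have hskew := apply_eq_neg_of_skew hM
  have hA : M.toBlocks₁₁ᵀ = -M.toBlocks₁₁ := by ext; exact hskew _ _
  have hB : M.toBlocks₁₂ᵀ = -M.toBlocks₂₁ := by ext; exact hskew _ _
  have hC : M.toBlocks₂₁ᵀ = -M.toBlocks₁₂ := by ext; exact hskew _ _
  have hD : M.toBlocks₂₂ᵀ = -M.toBlocks₂₂ := by ext; exact hskew _ _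
  have hdet : M.toBlocks₁₁.det = M (.inl 0) (.inl 1) ^ 2 := by
    simp only [det_fin_two, toBlocks₁₁, of_apply, apply_self_eq_zero_of_skew hM (.inl 0),
      hskew (.inl 1) (.inl 0)]
    ring
  have hunit : IsUnit M.toBlocks₁₁.det := by simpa [hdet] using h
  let _ := invertibleOfIsUnitDet _ hunit
  have hAinv : (⅟M.toBlocks₁₁)ᵀ = -⅟M.toBlocks₁₁ := by
    rw [invOf_eq_nonsing_inv, transpose_nonsing_inv, hA]
    exact inv_eq_left_inv (by rw [neg_mul_neg, nonsing_inv_mul _ hunit])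
  refine ⟨M.toBlocks₂₂ - M.toBlocks₂₁ * ⅟M.toBlocks₁₁ * M.toBlocks₁₂, ?_, ?_⟩
  · simp only [transpose_sub, transpose_mul, hB, hC, hD, hAinv, Matrix.neg_mul, Matrix.mul_neg,
      neg_neg, neg_sub, Matrix.mul_assoc]
    abel
  · rw [← hdet, ← det_fromBlocks₁₁, fromBlocks_toBlocks]

theorem isSquare_det_of_skew_of_card [NeZero (2 : F)] (k : ℕ) {n : Type*} [Fintype n]
    [DecidableEq n] (hn : Fintype.card n = k) {M : Matrix n n F} (hM : Mᵀ = -M) :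
    IsSquare M.det := by
  induction k using Nat.strong_induction_on generalizing n with
  | _ k ih =>
  by_cases hM0 : M = 0
  · rcases isEmpty_or_nonempty n with h | h <;> simp [hM0]
  obtain ⟨i, j, hij⟩ : ∃ i j, M i j ≠ 0 := by
    by_contra! h
    exact hM0 (Matrix.ext h)
  have hne : i ≠ j := by
    rintro rfl
    exact hij (apply_self_eq_zero_of_skew hM i)
  have hinj : Function.Injective ![i, j] := by
    intro a b
    fin_cases a <;> fin_cases b <;> simp [hne, hne.symm]
  let e : Fin 2 ⊕ ↥(Set.range ![i, j])ᶜ ≃ n :=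
    ((Equiv.ofInjective _ hinj).sumCongr (.refl _)).trans (Equiv.Set.sumCompl _)
  obtain ⟨N, hN, hdet⟩ := exists_skew_schur_complement (M := M.submatrix e e)
    (by rw [transpose_submatrix, hM]; rfl) hij
  rw [← det_submatrix_equiv_self e, hdet]
  have hcard := Fintype.card_congr e
  rw [Fintype.card_sum, Fintype.card_fin] at hcard
  exact (IsSquare.sq _).mul (ih _ (by omega) rfl hN)

theorem isSquare_of_isSquare_algebraMap [IsDomain R] [IsIntegrallyClosed R] {a : R}
    (h : IsSquare (algebraMap R (FractionRing R) a)) : IsSquare a := by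
  obtain ⟨q, hq⟩ := h
  have hintegral : IsIntegral R q :=
    .of_pow (n := 2) two_pos (by rw [sq, ← hq]; exact isIntegral_algebraMap)
  obtain ⟨p, rfl⟩ := IsIntegrallyClosed.isIntegral_iff.1 hintegral
  exact ⟨p, IsFractionRing.injective R (FractionRing R) (by rw [hq, map_mul])⟩

theorem isSquare_det_of_skew [IsDomain R] [IsIntegrallyClosed R] [NeZero (2 : R)]
    {M : Matrix n n R} (hM : Mᵀ = -M) : IsSquare M.det := by
  let ι := algebraMap R (FractionRing R)
  have : NeZero (2 : FractionRing R) :=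
    NeZero.nat_of_injective (n := 2) (IsFractionRing.injective R (FractionRing R))
  refine isSquare_of_isSquare_algebraMap (?_ : IsSquare (ι M.det))
  rw [RingHom.map_det]
  refine isSquare_det_of_skew_of_card _ rfl ?_
  rw [RingHom.mapMatrix_apply, ← transpose_map, hM]
  ext
  simp

theorem C_det_mul_charpoly_inv_mul {S : Matrix n n R} (hS : IsUnit S.det) (M : Matrix n n R) :
    C S.det * (S⁻¹ * M).charpoly = ((X : R[X]) • S.map C - M.map C).det := by
  rw [charpoly, RingHom.map_det, RingHom.mapMatrix_apply, ← det_mul, charmatrix, mul_sub,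
    RingHom.mapMatrix_apply, ← Matrix.map_mul, ← Matrix.mul_assoc, mul_nonsing_inv _ hS,
    Matrix.one_mul, Matrix.scalar_apply, ← Matrix.smul_one_eq_diagonal, Matrix.mul_smul,
    Matrix.mul_one]

theorem exists_monic_sq_eq [IsDomain R] {p : R[X]} (hp : p.Monic) (h : IsSquare p) :
    ∃ q : R[X], q.Monic ∧ q ^ 2 = p := by
  obtain ⟨q, rfl⟩ := h
  have hlead : q.leadingCoeff ^ 2 = 1 := by rw [sq, ← leadingCoeff_mul, hp]
  rcases sq_eq_one_iff.1 hlead with h | h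
  · exact ⟨q, h, sq q⟩
  · exact ⟨-q, by rw [Monic, leadingCoeff_neg, h, neg_neg], by rw [neg_sq, sq]⟩

theorem exists_monic_sq_eq_charpoly_of_skew [NeZero (2 : F)] {S M : Matrix n n F} (hS : Sᵀ = -S)
    (hM : Mᵀ = -M) (hS' : IsUnit S.det) : ∃ p : F[X], p.Monic ∧ p ^ 2 = (S⁻¹ * M).charpoly := by
  have : NeZero (2 : F[X]) :=
    NeZero.nat_of_injective (n := 2) (C_injective (R := F))
  have hpencil : IsSquare ((X : F[X]) • S.map C - M.map C).det := by
    refine isSquare_det_of_skew ?_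
    rw [transpose_sub, transpose_smul, ← transpose_map, ← transpose_map, hS, hM]
    ext
    simp
    ring
  obtain ⟨s, hs⟩ := isSquare_det_of_skew hS
  have hs0 : s ≠ 0 := by
    rintro rfl
    simp [hs] at hS'
  refine exists_monic_sq_eq (charpoly_monic _) ?_
  have hcharpoly : (S⁻¹ * M).charpoly = C s⁻¹ ^ 2 * ((X : F[X]) • S.map C - M.map C).det := by
    rw [← C_det_mul_charpoly_inv_mul hS' M, ← mul_assoc, hs, ← C_pow, ← C_mul]
    field_simp
    simp
  rw [hcharpoly]
  exact (IsSquare.sq _).mul hpencil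

end SkewMatrices

section MatrixAlgebras

open Matrix Polynomial

variable {R K E A n o : Type*} [CommRing R] [Field K] [Field E] [Algebra K E] [Ring A] [Algebra K A]
  [Fintype n] [DecidableEq n] [Fintype o] [DecidableEq o]

theorem charpoly_blockDiagonal_const (M : Matrix n n R) :
    (blockDiagonal fun _ : o => M).charpoly = M.charpoly ^ Fintype.card o := by
  have : charmatrix (blockDiagonal fun _ : o => M) = blockDiagonal fun _ : o => charmatrix M := by
    ext ⟨i, k⟩ ⟨j, l⟩
    by_cases hkl : k = l <;> by_cases hij : i = j <;> simp [blockDiagonal_apply, hkl, hij]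
  rw [charpoly, this, det_blockDiagonal, Finset.prod_const, Finset.card_univ, charpoly]

theorem toMatrix_stdBasis_mulLeft (M : Matrix n n R) :
    LinearMap.toMatrix (stdBasis R n n) (stdBasis R n n) (LinearMap.mulLeft R M) =
      blockDiagonal fun _ => M := by
  ext ⟨i, k⟩ ⟨j, l⟩
  have hcoord : (stdBasis R n n).coord (i, k) = entryLinearMap R R i k :=
    (stdBasis R n n).ext fun ⟨a, b⟩ => by
      rw [Module.Basis.coord_apply, Module.Basis.repr_self, stdBasis_eq_single,
        entryLinearMap_apply, Finsupp.single_apply, Matrix.single_apply]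
      simp only [Prod.mk.injEq]
  rw [LinearMap.toMatrix_apply, ← Module.Basis.coord_apply, hcoord, stdBasis_eq_single,
    entryLinearMap_apply, LinearMap.mulLeft_apply, blockDiagonal_apply]
  by_cases hkl : k = l
  · subst hkl
    simp
  · simp [hkl]

theorem charpoly_mulLeft (M : Matrix n n R) :
    (LinearMap.mulLeft R M).charpoly = M.charpoly ^ Fintype.card n := by
  rw [← LinearMap.charpoly_toMatrix _ (stdBasis R n n), toMatrix_stdBasis_mulLeft,
    charpoly_blockDiagonal_const]

theorem conj_baseChange_mulLeft (f : (E ⊗[K] A) ≃ₐ[E] Matrix n n E) (a : A) :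
    f.toLinearEquiv.conj ((LinearMap.mulLeft K a).baseChange E) =
      LinearMap.mulLeft E (f (1 ⊗ₜ[K] a)) := by
  have hmul : (LinearMap.mulLeft K a).baseChange E = LinearMap.mulLeft E ((1 : E) ⊗ₜ[K] a) := by
    ext
    simp
  ext1 x
  simp [hmul, LinearEquiv.conj_apply]

theorem map_charpoly_mulLeft [FiniteDimensional K A] (f : (E ⊗[K] A) ≃ₐ[E] Matrix n n E) (a : A) :
    (LinearMap.mulLeft K a).charpoly.map (algebraMap K E) =
      (f (1 ⊗ₜ[K] a)).charpoly ^ Fintype.card n := by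
  rw [← LinearMap.charpoly_baseChange, ← LinearEquiv.charpoly_conj f.toLinearEquiv,
    conj_baseChange_mulLeft, charpoly_mulLeft]

theorem eq_of_monic_of_pow_eq {P Q : K[X]} (hP : P.Monic) (hQ : Q.Monic) {n : ℕ} (hn : n ≠ 0)
    (h : P ^ n = Q ^ n) : P = Q := by
  classical
  exact eq_of_monic_of_associated hP hQ <| associated_of_dvd_dvd
    ((UniqueFactorizationMonoid.pow_dvd_pow_iff_dvd hn).1 h.dvd)
    ((UniqueFactorizationMonoid.pow_dvd_pow_iff_dvd hn).1 h.symm.dvd)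

end MatrixAlgebras

section Schur

variable {F G V W X : Type*} [Field F] [CharZero F] [Group G] [Fintype G]
  [AddCommGroup V] [Module F V] [FiniteDimensional F V]
  [AddCommGroup W] [Module F W] [FiniteDimensional F W] [AddCommGroup X] [Module F X]
  {ρ : Representation F G V} {σ : Representation F G W}

theorem sum_character_mul_character_inv (ρ : Representation F G V) (σ : Representation F G W) :
    ∑ g, σ.character g * ρ.character g⁻¹ =
      Nat.card G * (Module.finrank F (ρ.IntertwiningMap σ) : F) := by
  have hG : (Nat.card G : F) ≠ 0 := Nat.cast_ne_zero.2 Nat.card_pos.ne'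
  let _ := invertibleOfNonzero hG
  rw [← Representation.card_inv_mul_sum_char_mul_char_eq_finrank ρ σ, mul_inv_cancel_left₀ hG]

theorem finrank_intertwiningMap_eq_one
    (h : ∑ g, σ.character g * ρ.character g⁻¹ = (Nat.card G : F)) :
    Module.finrank F (ρ.IntertwiningMap σ) = 1 := by
  have hG : (Nat.card G : F) ≠ 0 := Nat.cast_ne_zero.2 Nat.card_pos.ne'
  rwa [sum_character_mul_character_inv, mul_eq_left₀ hG, Nat.cast_eq_one] at h

theorem exists_eq_smul_of_intertwining
    (h : ∑ g, σ.character g * ρ.character g⁻¹ = (Nat.card G : F)) {f : V →ₗ[F] W}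
    (hf : ∀ g v, f (ρ g v) = σ g (f v)) (hf0 : f ≠ 0) {f' : V →ₗ[F] W}
    (hf' : ∀ g v, f' (ρ g v) = σ g (f' v)) : ∃ c : F, f' = c • f := by
  have hf0' : f.intertwiningMap_of_isIntertwiningMap ρ σ hf ≠ 0 := fun h0 =>
    hf0 (LinearMap.ext fun v => DFunLike.congr_fun h0 v)
  obtain ⟨c, hc⟩ := (finrank_eq_one_iff_of_nonzero' _ hf0').1 (finrank_intertwiningMap_eq_one h)
    (f'.intertwiningMap_of_isIntertwiningMap ρ σ hf')
  exact ⟨c, LinearMap.ext fun v => (DFunLike.congr_fun hc v).symm⟩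

/-- A representation is *absolutely irreducible* if its character has norm one. This makes the
notion visibly stable under extension of scalars; over an algebraically closed field of
characteristic zero it is ordinary irreducibility. -/
def IsAbsIrreducible (ρ : Representation F G V) : Prop :=
  ∑ g, ρ.character g * ρ.character g⁻¹ = (Nat.card G : F)

namespace IsAbsIrreducible

theorem finrank_ne_zero (hρ : IsAbsIrreducible ρ) : Module.finrank F V ≠ 0 := by
  intro h
  have := Module.finrank_zero_iff.1 h
  have hχ (g : G) : ρ.character g = 0 := by
    rw [Representation.character, Subsingleton.elim (ρ g) 0, map_zero]
  simp only [IsAbsIrreducible, hχ, mul_zero, Finset.sum_const_zero] at hρ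
  exact Nat.cast_ne_zero.2 Nat.card_pos.ne' hρ.symm

theorem exists_eq_smul_one (hρ : IsAbsIrreducible ρ) {f : Module.End F V}
    (hf : ∀ g, f * ρ g = ρ g * f) : ∃ c : F, f = c • 1 := by
  have : Nontrivial V := Module.nontrivial_of_finrank_pos (Nat.pos_of_ne_zero hρ.finrank_ne_zero)
  exact exists_eq_smul_of_intertwining hρ (f := 1) (fun _ _ => rfl) one_ne_zero
    fun g v => LinearMap.congr_fun (hf g) v

theorem sum_conj_eq_smul_one (hρ : IsAbsIrreducible ρ) (x : Module.End F V) :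
    ∑ g, ρ g * x * ρ g⁻¹ =
      (Nat.card G * (Module.finrank F V : F)⁻¹ * LinearMap.trace F V x) • 1 := by
  have hn : (Module.finrank F V : F) ≠ 0 := Nat.cast_ne_zero.2 hρ.finrank_ne_zero
  have hcomm (h : G) : (∑ g, ρ g * x * ρ g⁻¹) * ρ h = ρ h * ∑ g, ρ g * x * ρ g⁻¹ := by
    rw [Finset.sum_mul, Finset.mul_sum]
    refine Fintype.sum_equiv (Equiv.mulLeft h⁻¹) _ _ fun g => ?_
    have hcancel : ρ h * ρ h⁻¹ = 1 := by rw [← map_mul, mul_inv_cancel, map_one]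
    simp only [Equiv.coe_mulLeft, map_mul, mul_inv_rev, inv_inv, ← mul_assoc, hcancel, one_mul]
  have htrace (g : G) : LinearMap.trace F V (ρ g * x * ρ g⁻¹) = LinearMap.trace F V x := by
    rw [LinearMap.trace_mul_comm, ← mul_assoc, ← map_mul, inv_mul_cancel, map_one, one_mul]
  obtain ⟨c, hc⟩ := hρ.exists_eq_smul_one hcomm
  have h := congrArg (LinearMap.trace F V) hc
  simp only [map_sum, htrace, Finset.sum_const, Finset.card_univ, nsmul_eq_mul, map_smul,
    LinearMap.trace_one, smul_eq_mul] at h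
  rw [hc, Nat.card_eq_fintype_card, mul_right_comm, h, mul_inv_cancel_right₀ hn]

theorem schur_relation (hρ : IsAbsIrreducible ρ) (ψ : Module.Dual F V) (v w : V) :
    ∑ g, ψ (ρ g⁻¹ w) • ρ g v = (Nat.card G * (Module.finrank F V : F)⁻¹ * ψ v) • w := by
  have h := LinearMap.congr_fun (hρ.sum_conj_eq_smul_one (ψ.smulRight v)) w
  rw [LinearMap.trace_smulRight] at h
  simpa [LinearMap.sum_apply] using h

theorem sum_bilin_apply_inv_apply (hρ : IsAbsIrreducible ρ) (B : LinearMap.BilinForm F V)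
    (v w : V) :
    ∑ g, B (ρ g⁻¹ w) (ρ g v) = Nat.card G * (Module.finrank F V : F)⁻¹ * B v w := by
  let b := Module.finBasis F V
  have hexpand (x y : V) : B x y = ∑ j, b.coord j x • B (b j) y := by
    conv_lhs => rw [← b.sum_repr x]
    simp only [map_sum, LinearMap.sum_apply, map_smul, LinearMap.smul_apply, b.coord_apply]
  calc ∑ g, B (ρ g⁻¹ w) (ρ g v)
      = ∑ j, B (b j) (∑ g, b.coord j (ρ g⁻¹ w) • ρ g v) := by
        simp only [fun g => hexpand (ρ g⁻¹ w), map_sum, map_smul]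
        exact Finset.sum_comm
    _ = Nat.card G * (Module.finrank F V : F)⁻¹ * B v w := by
        simp only [hρ.schur_relation, map_smul, hexpand v w, Finset.mul_sum, smul_eq_mul, mul_assoc]

theorem fourier_inversion_smulRight (hρ : IsAbsIrreducible ρ) (ψ : Module.Dual F V) (w : V) :
    (ψ.smulRight w : Module.End F V) = (Module.finrank F V * (Nat.card G : F)⁻¹) •
      ∑ g, LinearMap.trace F V (ψ.smulRight w * ρ g⁻¹) • ρ g := by
  have hn : (Module.finrank F V : F) ≠ 0 := Nat.cast_ne_zero.2 hρ.finrank_ne_zero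
  have hG : (Nat.card G : F) ≠ 0 := Nat.cast_ne_zero.2 Nat.card_pos.ne'
  have htrace (g : G) : LinearMap.trace F V (ψ.smulRight w * ρ g⁻¹) = ψ (ρ g⁻¹ w) :=
    LinearMap.trace_smulRight (ψ ∘ₗ ρ g⁻¹) w
  ext v
  simp only [htrace, LinearMap.smul_apply, LinearMap.sum_apply, hρ.schur_relation, smul_smul,
    LinearMap.smulRight_apply]
  congr 1
  field_simp

theorem fourier_inversion (hρ : IsAbsIrreducible ρ) (x : Module.End F V) :
    x = (Module.finrank F V * (Nat.card G : F)⁻¹) •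
      ∑ g, LinearMap.trace F V (x * ρ g⁻¹) • ρ g := by
  let b := Module.finBasis F V
  have hx : x = ∑ i, (b.coord i).smulRight (x (b i)) :=
    b.ext fun j => by simp [LinearMap.sum_apply, Finsupp.single_apply, ite_smul]
  rw [hx]
  conv_lhs => enter [2, i]; rw [hρ.fourier_inversion_smulRight]
  rw [← Finset.smul_sum, Finset.sum_comm]
  simp only [Finset.sum_mul, map_sum, Finset.sum_smul]

theorem span_range_eq_top (hρ : IsAbsIrreducible ρ) : Submodule.span F (Set.range ρ) = ⊤ := by
  refine eq_top_iff.2 fun x _ => ?_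
  rw [hρ.fourier_inversion x]
  exact Submodule.smul_mem _ _ (Submodule.sum_mem _ fun g _ =>
    Submodule.smul_mem _ _ (Submodule.subset_span ⟨g, rfl⟩))

theorem eq_top_of_forall_mem (hρ : IsAbsIrreducible ρ) {S : Submodule F (Module.End F V)}
    (h : ∀ g, ρ g ∈ S) : S = ⊤ := by
  rw [eq_top_iff, ← hρ.span_range_eq_top, Submodule.span_le]
  rintro _ ⟨g, rfl⟩
  exact h g

theorem injective_of_ker_invariant (hρ : IsAbsIrreducible ρ) {f : V →ₗ[F] X} (hf0 : f ≠ 0)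
    (hf : ∀ g v, f v = 0 → f (ρ g v) = 0) : Function.Injective f := by
  rw [injective_iff_map_eq_zero]
  intro v hv
  by_contra hv0
  have hall (x : Module.End F V) : f (x v) = 0 := by
    have hker : LinearMap.ker (f ∘ₗ LinearMap.applyₗ v) = ⊤ :=
      hρ.eq_top_of_forall_mem fun g => hf g v hv
    exact LinearMap.mem_ker.1 (hker ▸ Submodule.mem_top : x ∈ LinearMap.ker _)
  obtain ⟨ψ, hψ⟩ := Module.Projective.exists_dual_eq_one F hv0
  exact hf0 (LinearMap.ext fun w => by simpa [hψ] using hall (ψ.smulRight w))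

end IsAbsIrreducible

end Schur

section TwistedForms

variable {F G V : Type*} [Field F] [Group G] [AddCommGroup V] [Module F V]
  {ρ : Representation F G V} {α : MulAut G} {B B' : LinearMap.BilinForm F V}

/-- `B` pairs the representation `ρ` with its twist by `α`: `B (g v) (α(g) w) = B v w`. For `α = 1`
these are the invariant forms. -/
def TwistedInvariant (ρ : Representation F G V) (α : MulAut G) (B : LinearMap.BilinForm F V) :
    Prop :=
  ∀ g v w, B (ρ g v) (ρ (α g) w) = B v w

/-- The dual of the twist of `ρ` by `α`; a form with `TwistedInvariant ρ α` is the same as an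
intertwining map from `ρ` to it. -/
def twistedDual (ρ : Representation F G V) (α : MulAut G) :
    Representation F G (Module.Dual F V) :=
  Representation.dual (ρ.comp α.toMonoidHom)

theorem twistedDual_apply (g : G) (ψ : Module.Dual F V) (v : V) :
    twistedDual ρ α g ψ v = ψ (ρ (α g⁻¹) v) := rfl

theorem twistedInvariant_iff :
    TwistedInvariant ρ α B ↔ ∀ g v, B (ρ g v) = twistedDual ρ α g (B v) := by
  constructor
  · intro h g v
    ext w
    rw [twistedDual_apply, ← h g v, ← Module.End.mul_apply, ← map_mul, ← map_mul, mul_inv_cancel,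
      map_one, map_one, Module.End.one_apply]
  · intro h g v w
    rw [h, twistedDual_apply, ← Module.End.mul_apply, ← map_mul, ← map_mul, inv_mul_cancel,
      map_one, map_one, Module.End.one_apply]

theorem twistedDual_character [FiniteDimensional F V] (g : G) :
    (twistedDual ρ α).character g = ρ.character (α g⁻¹) :=
  Representation.char_dual _ g

theorem apply_apply_of_sq_eq_one (hα : α ^ 2 = 1) (g : G) : α (α g) = g := by
  rw [← MulAut.mul_apply, ← sq, hα, MulAut.one_apply]

theorem TwistedInvariant.apply_right (hB : TwistedInvariant ρ α B) (g : G) (v w : V) :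
    B v (ρ (α g) w) = B (ρ g⁻¹ v) w := by
  rw [← hB g (ρ g⁻¹ v) w, ← Module.End.mul_apply, ← map_mul, mul_inv_cancel, map_one,
    Module.End.one_apply]

theorem TwistedInvariant.flip (hB : TwistedInvariant ρ α B) (hα : α ^ 2 = 1) :
    TwistedInvariant ρ α B.flip := fun g v w => by
  have h := hB (α g) w v
  rwa [apply_apply_of_sq_eq_one hα] at h

theorem trace_eq_sum_apply_dualBasis {ι : Type*} [Fintype ι] [DecidableEq ι]
    (hB : B.Nondegenerate) (b : Module.Basis ι F V) (f : Module.End F V) :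
    LinearMap.trace F V f = ∑ i, B (B.dualBasis hB b i) (f (b i)) := by
  have hdual (i : ι) : B (B.dualBasis hB b i) = b.coord i :=
    b.ext fun j => by
      rw [B.apply_dualBasis_left, b.coord_apply, b.repr_self, Finsupp.single_apply]
  rw [LinearMap.trace_eq_matrix_trace F b, Matrix.trace]
  exact Finset.sum_congr rfl fun i _ => by
    rw [hdual, Matrix.diag_apply, LinearMap.toMatrix_apply, b.coord_apply]

variable [CharZero F] [Fintype G] [FiniteDimensional F V]

theorem exists_twistedInvariant (h : ∑ g, ρ.character g * ρ.character (α g) ≠ 0) :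
    ∃ B : LinearMap.BilinForm F V, B ≠ 0 ∧ TwistedInvariant ρ α B := by
  have hsum : ∑ g, (twistedDual ρ α).character g * ρ.character g⁻¹ ≠ 0 := by
    rw [← Equiv.sum_comp (Equiv.inv G)] at h
    simpa only [twistedDual_character, Equiv.inv_apply, mul_comm] using h
  rw [sum_character_mul_character_inv] at hsum
  have : Nontrivial (ρ.IntertwiningMap (twistedDual ρ α)) :=
    Module.nontrivial_of_finrank_pos (R := F) (Nat.pos_of_ne_zero fun h0 => hsum (by simp [h0]))
  obtain ⟨f, hf⟩ := exists_ne (0 : ρ.IntertwiningMap (twistedDual ρ α))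
  exact ⟨f.toLinearMap, fun h => hf (Representation.IntertwiningMap.ext h),
    twistedInvariant_iff.2 fun g v => f.isIntertwining _ _ g v⟩

theorem TwistedInvariant.eq_zero (hB : TwistedInvariant ρ α B)
    (h : ∑ g, ρ.character g * ρ.character (α g) = 0) : B = 0 := by
  have hsum : ∑ g, (twistedDual ρ α).character g * ρ.character g⁻¹ = 0 := by
    rw [← Equiv.sum_comp (Equiv.inv G)] at h
    simpa only [twistedDual_character, Equiv.inv_apply, mul_comm] using h
  have hG : (Nat.card G : F) ≠ 0 := Nat.cast_ne_zero.2 Nat.card_pos.ne'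
  rw [sum_character_mul_character_inv, mul_eq_zero, or_iff_right hG, Nat.cast_eq_zero] at hsum
  have := (Module.finrank_zero_iff (R := F) (M := ρ.IntertwiningMap (twistedDual ρ α))).1 hsum
  let f := B.intertwiningMap_of_isIntertwiningMap ρ (twistedDual ρ α) (twistedInvariant_iff.1 hB)
  exact LinearMap.ext fun v => DFunLike.congr_fun (Subsingleton.elim f 0) v

namespace TwistedInvariant

theorem injective (hB : TwistedInvariant ρ α B) (hρ : IsAbsIrreducible ρ) (hB0 : B ≠ 0) :
    Function.Injective B :=
  hρ.injective_of_ker_invariant hB0 fun g v hv => by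
    rw [twistedInvariant_iff.1 hB, hv, map_zero]

theorem nondegenerate (hB : TwistedInvariant ρ α B) (hρ : IsAbsIrreducible ρ) (hB0 : B ≠ 0) :
    B.Nondegenerate :=
  LinearMap.BilinForm.nondegenerate_iff_ker_eq_bot.2 (LinearMap.ker_eq_bot.2 (hB.injective hρ hB0))

theorem character_apply (hB : TwistedInvariant ρ α B) (hρ : IsAbsIrreducible ρ) (hB0 : B ≠ 0)
    (g : G) : ρ.character (α g) = ρ.character g⁻¹ := by
  let e := B.toDual (hB.nondegenerate hρ hB0)
  have hiso := Representation.char_iso (Representation.Equiv.mk (σ := twistedDual ρ α) e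
    fun g => LinearMap.ext fun v => twistedInvariant_iff.1 hB g v)
  rw [congrFun hiso g⁻¹, twistedDual_character, inv_inv]

theorem exists_eq_smul (hB : TwistedInvariant ρ α B) (hρ : IsAbsIrreducible ρ) (hB0 : B ≠ 0)
    (hB' : TwistedInvariant ρ α B') : ∃ c : F, B' = c • B := by
  refine exists_eq_smul_of_intertwining (σ := twistedDual ρ α) ?_
    (twistedInvariant_iff.1 hB) hB0 (twistedInvariant_iff.1 hB')
  simp only [twistedDual_character, hB.character_apply hρ hB0, inv_inv]
  exact hρ

theorem exists_flip_eq_smul (hB : TwistedInvariant ρ α B) (hρ : IsAbsIrreducible ρ) (hB0 : B ≠ 0)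
    (hα : α ^ 2 = 1) : ∃ ε : F, (ε = 1 ∨ ε = -1) ∧ B.flip = ε • B := by
  obtain ⟨c, hc⟩ := hB.exists_eq_smul hρ hB0 (hB.flip hα)
  have hflip (v w : V) : B w v = c * B v w := LinearMap.congr_fun₂ hc v w
  have hsq : (c ^ 2 - 1) • B = 0 := by
    ext v w
    simp only [LinearMap.smul_apply, smul_eq_mul, LinearMap.zero_apply]
    linear_combination -hflip w v - c * hflip v w
  rw [smul_eq_zero, or_iff_left hB0, sub_eq_zero] at hsq
  exact ⟨c, sq_eq_one_iff.1 hsq, hc⟩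

-- The twisted Frobenius–Schur formula (Kawanaka–Matsuyama).
theorem sum_character_mul_twist (hB : TwistedInvariant ρ α B) (hρ : IsAbsIrreducible ρ)
    (hB0 : B ≠ 0) {ε : F} (hε : B.flip = ε • B) :
    ∑ g, ρ.character (g * α g) = ε * Nat.card G := by
  have hn : (Module.finrank F V : F) ≠ 0 := Nat.cast_ne_zero.2 hρ.finrank_ne_zero
  let b := Module.finBasis F V
  have hnd := hB.nondegenerate hρ hB0
  let b' := B.dualBasis hnd b
  have hpair (i) : B (b i) (b' i) = ε := by
    have hflip : B (b i) (b' i) = ε * B (b' i) (b i) := LinearMap.congr_fun₂ hε (b' i) (b i)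
    rw [hflip, B.apply_dualBasis_left, if_pos rfl, mul_one]
  calc ∑ g, ρ.character (g * α g)
      = ∑ g, ∑ i, B (ρ g⁻¹ (b' i)) (ρ g (b i)) := Finset.sum_congr rfl fun g _ => by
        rw [Representation.char_mul_comm]
        simp only [Representation.character, trace_eq_sum_apply_dualBasis hnd b, map_mul,
          Module.End.mul_apply, hB.apply_right, b']
    _ = ∑ i, ∑ g, B (ρ g⁻¹ (b' i)) (ρ g (b i)) := Finset.sum_comm
    _ = ∑ _i : Fin (Module.finrank F V), Nat.card G * (Module.finrank F V : F)⁻¹ * ε := by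
        simp only [hρ.sum_bilin_apply_inv_apply, hpair]
    _ = ε * Nat.card G := by
        rw [Finset.sum_const, Finset.card_univ, Fintype.card_fin, nsmul_eq_mul]
        field_simp

end TwistedInvariant

omit [CharZero F] [FiniteDimensional F V] in
theorem twistedInvariant_sum (φ ψ : Module.Dual F V) :
    TwistedInvariant ρ α (∑ g, (φ ∘ₗ ρ g).smulRight (ψ ∘ₗ ρ (α g))) := fun h v w => by
  simp only [LinearMap.sum_apply, LinearMap.smulRight_apply, LinearMap.smul_apply,
    LinearMap.comp_apply]
  exact Fintype.sum_equiv (Equiv.mulRight h) _ _ fun g => by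
    simp only [Equiv.coe_mulRight, map_mul, Module.End.mul_apply]

-- Each matrix coefficient of `∑ g, ρ g ∘ ρ (α g)` is a value of an averaged twisted invariant form.
theorem sum_character_mul_twist_eq_zero (h : ∑ g, ρ.character g * ρ.character (α g) = 0) :
    ∑ g, ρ.character (g * α g) = 0 := by
  let b := Module.finBasis F V
  have htrace (g : G) : ρ.character (g * α g) =
      ∑ i, ∑ j, b.coord i (ρ g (b j)) * b.coord j (ρ (α g) (b i)) := by
    rw [Representation.character, map_mul, LinearMap.trace_eq_matrix_trace F b,
      LinearMap.toMatrix_mul, Matrix.trace]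
    simp only [Matrix.diag_apply, Matrix.mul_apply, LinearMap.toMatrix_apply, b.coord_apply]
  have hcoeff (i j) : ∑ g, b.coord i (ρ g (b j)) * b.coord j (ρ (α g) (b i)) = 0 := by
    have h0 := (twistedInvariant_sum (ρ := ρ) (α := α) (b.coord i) (b.coord j)).eq_zero h
    simpa [LinearMap.sum_apply] using LinearMap.congr_fun₂ h0 (b j) (b i)
  simp only [htrace]
  rw [Finset.sum_comm]
  refine Finset.sum_eq_zero fun i _ => ?_
  rw [Finset.sum_comm]
  exact Finset.sum_eq_zero fun j _ => hcoeff i j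

end TwistedForms

section Eigenvalues

theorem exists_trace_pow_eq_sum {F V : Type*} [Field F] [IsAlgClosed F] [CharZero F]
    [AddCommGroup V] [Module F V] [FiniteDimensional F V] {f : Module.End F V} {N : ℕ}
    (hN : N ≠ 0) (hf : f ^ N = 1) :
    ∃ (s : Finset F) (m : F → ℕ), (∀ μ ∈ s, μ ^ N = 1) ∧
      ∀ k, LinearMap.trace F V (f ^ k) = ∑ μ ∈ s, m μ * μ ^ k := by
  classical
  have hss : f.IsSemisimple := Module.End.isSemisimple_of_squarefree_aeval_eq_zero
    (Polynomial.X_pow_sub_one_separable_iff.2 (Nat.cast_ne_zero.2 hN)).squarefree (by simp [hf])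
  have hinternal : DirectSum.IsInternal f.eigenspace :=
    (DirectSum.isInternal_submodule_iff_iSupIndep_and_iSup_eq_top _).2
      ⟨f.eigenspaces_iSupIndep, hss.iSup_eigenspace_eq_top⟩
  have hfin := WellFoundedGT.finite_ne_bot_of_iSupIndep f.eigenspaces_iSupIndep
  have hpow (k : ℕ) (μ : F) {v : V} (hv : v ∈ f.eigenspace μ) : (f ^ k) v = μ ^ k • v := by
    induction k with
    | zero => simp
    | succ k ih =>
      rw [pow_succ', pow_succ', Module.End.mul_apply, ih, map_smul,
        Module.End.mem_eigenspace_iff.1 hv, smul_smul, mul_comm]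
  refine ⟨hfin.toFinset, fun μ => Module.finrank F (f.eigenspace μ), fun μ hμ => ?_, fun k => ?_⟩
  · obtain ⟨v, hv, hv0⟩ := Submodule.exists_mem_ne_zero_of_ne_bot (hfin.mem_toFinset.1 hμ)
    have h := hpow N μ hv
    rw [hf, Module.End.one_apply] at h
    exact smul_left_injective F hv0 (h.symm.trans (one_smul F v).symm)
  · have hmaps (μ : F) : Set.MapsTo (f ^ k) (f.eigenspace μ) (f.eigenspace μ) := fun v hv => by
      rw [hpow k μ hv]
      exact Submodule.smul_mem _ _ hv
    rw [LinearMap.trace_eq_sum_trace_restrict' hinternal hfin hmaps]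
    refine Finset.sum_congr rfl fun μ _ => ?_
    have hrestrict : (f ^ k).restrict (hmaps μ) = μ ^ k • LinearMap.id :=
      LinearMap.ext fun v => Subtype.ext (hpow k μ v.2)
    rw [hrestrict, map_smul, LinearMap.trace_id, smul_eq_mul, mul_comm]

theorem exists_character_pow_eq_sum {F G V : Type*} [Field F] [IsAlgClosed F] [CharZero F]
    [Group G] [Finite G] [AddCommGroup V] [Module F V] [FiniteDimensional F V]
    (τ : Representation F G V) (g : G) :
    ∃ (s : Finset F) (m : F → ℕ), (∀ μ ∈ s, μ ^ Nat.card G = 1) ∧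
      ∀ k, τ.character (g ^ k) = ∑ μ ∈ s, m μ * μ ^ k := by
  simp only [Representation.character, map_pow]
  exact exists_trace_pow_eq_sum Nat.card_pos.ne' (by rw [← map_pow, pow_card_eq_one', map_one])

theorem character_inv_eq_conj {G V : Type*} [Group G] [Finite G] [AddCommGroup V] [Module ℂ V]
    [FiniteDimensional ℂ V] (τ : Representation ℂ G V) (g : G) :
    τ.character g⁻¹ = conj (τ.character g) := by
  obtain ⟨s, m, hs, htrace⟩ := exists_character_pow_eq_sum τ g
  have hG : Nat.card G ≠ 0 := Nat.card_pos.ne'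
  have hinv : g⁻¹ = g ^ (Nat.card G - 1) := by
    rw [inv_eq_iff_mul_eq_one, mul_pow_sub_one hG, pow_card_eq_one']
  have hg := htrace 1
  rw [pow_one] at hg
  rw [hinv, htrace, hg, map_sum]
  refine Finset.sum_congr rfl fun μ hμ => ?_
  rw [map_mul, map_natCast, pow_one,
    ← Complex.inv_eq_conj (Complex.norm_eq_one_of_pow_eq_one (hs μ hμ) hG)]
  rw [eq_inv_of_mul_eq_one_left ((pow_sub_one_mul hG μ).trans (hs μ hμ))]

end Eigenvalues

section IrreducibleCharacters

variable {G : Type*} [Group G] {χ : G → ℂ}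

theorem IsIrrChar.apply_conj (hχ : IsIrrChar χ) (g h : G) : χ (h * g * h⁻¹) = χ g := by
  obtain ⟨n, τ, -, hτ⟩ := hχ
  rw [← hτ, ← hτ, Representation.char_conj]

theorem IsIrrChar.apply_mul_comm (hχ : IsIrrChar χ) (g h : G) : χ (g * h) = χ (h * g) := by
  obtain ⟨n, τ, -, hτ⟩ := hχ
  rw [← hτ, ← hτ, Representation.char_mul_comm]

theorem IsIrrChar.apply_inv [Finite G] (hχ : IsIrrChar χ) (g : G) : χ g⁻¹ = conj (χ g) := by
  obtain ⟨n, τ, -, hτ⟩ := hχ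
  rw [← hτ, ← hτ, character_inv_eq_conj]

variable [Fintype G]

theorem IsIrrChar.exists_isAbsIrreducible (hχ : IsIrrChar χ) :
    ∃ (n : ℕ) (τ : Representation ℂ G (Fin n → ℂ)), Affords χ τ ∧ IsAbsIrreducible τ := by
  obtain ⟨n, τ, hτ, hA⟩ := hχ
  have hG : (Nat.card G : ℂ) ≠ 0 := Nat.cast_ne_zero.2 Nat.card_pos.ne'
  let _ : Invertible (Nat.card G : ℂ) := invertibleOfNonzero hG
  have h := Representation.char_orthonormal τ τ
  rw [if_pos ⟨Representation.Equiv.refl τ⟩, inv_mul_eq_iff_eq_mul₀ hG, mul_one] at h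
  exact ⟨n, τ, hA, h⟩

theorem IsIrrChar.sum_mul_inv (hχ : IsIrrChar χ) : ∑ g, χ g * χ g⁻¹ = Nat.card G := by
  obtain ⟨n, τ, hA, hτ⟩ := hχ.exists_isAbsIrreducible
  simpa only [IsAbsIrreducible, hA _] using hτ

theorem IsIrrChar.sum_sq_eq_zero (hχ : IsIrrChar χ) (hO : IndicatorO χ) :
    ∑ g, χ g * χ g = 0 := by
  obtain ⟨n, τ, hA, hτ⟩ := hχ.exists_isAbsIrreducible
  by_contra hne
  obtain ⟨B, hB0, hB⟩ := exists_twistedInvariant (ρ := τ) (α := 1)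
    (by simpa only [MulAut.one_apply, hA _] using hne)
  have hreal : RealValued χ := fun g => by
    rw [← hχ.apply_inv, ← hA, ← hA, ← hB.character_apply hτ hB0, MulAut.one_apply]
  have hnd := hB.nondegenerate hτ hB0
  have hinv : InvariantForm τ B := fun g v w => hB g v w
  obtain ⟨ε, rfl | rfl, hflip⟩ := hB.exists_flip_eq_smul hτ hB0 (one_pow 2)
  · have hsymm : B.IsSymm := ⟨fun v w => by simpa using (LinearMap.congr_fun₂ hflip v w).symm⟩
    exact hO.1 ⟨hreal, n, τ, hA, B, hsymm, hnd, hinv⟩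
  · have halt : B.IsAlt := fun v => self_eq_neg.1 (by simpa using LinearMap.congr_fun₂ hflip v v)
    exact hO.2 ⟨hreal, n, τ, hA, B, halt, hnd, hinv⟩

omit [Fintype G] in
theorem IsIrrChar.exists_apply_ne [Finite G] (hχ : IsIrrChar χ) (hO : IndicatorO χ)
    {α : MulAut G} (hχα : ∀ g, χ (α g) = conj (χ g)) : ∃ g, χ (α g) ≠ χ g := by
  have := Fintype.ofFinite G
  by_contra! hreal
  have hnorm := hχ.sum_mul_inv
  simp only [hχ.apply_inv, ← hχα, hreal, hχ.sum_sq_eq_zero hO] at hnorm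
  exact Nat.cast_ne_zero.2 Nat.card_pos.ne' hnorm.symm

end IrreducibleCharacters

section InducedCharacter

variable {G : Type*} [Group G] {χ : G → ℂ} {α : MulAut G}

/-- The automorphism `α`, as an element of the semidirect product `G : ⟨α⟩`. -/
def twistElement (α : MulAut G) : ExtGroup α :=
  SemidirectProduct.inr ⟨α, Subgroup.mem_zpowers α⟩

theorem univ_zpowers_eq_pair [DecidableEq (Subgroup.zpowers α)] [Fintype (Subgroup.zpowers α)]
    (hα : α ^ 2 = 1) :
    (Finset.univ : Finset (Subgroup.zpowers α)) = {1, ⟨α, Subgroup.mem_zpowers α⟩} := by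
  refine (Finset.eq_univ_iff_forall.2 fun ⟨β, hβ⟩ => ?_).symm
  obtain ⟨k, rfl⟩ := Subgroup.mem_zpowers_iff.1 hβ
  obtain ⟨l, rfl | rfl⟩ := Int.even_or_odd' k
  · simp [zpow_mul, hα]
  · simp [zpow_add, zpow_mul, hα]

theorem sum_extGroup [Fintype G] [Fintype (ExtGroup α)] {M : Type*} [AddCommMonoid M]
    (hα : α ^ 2 = 1) (hα1 : α ≠ 1) (f : ExtGroup α → M) :
    ∑ x, f x =
      ∑ g, f (SemidirectProduct.inl g) + ∑ g, f (SemidirectProduct.inl g * twistElement α) := by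
  classical
  let _ := Fintype.ofFinite (Subgroup.zpowers α)
  have hne : (1 : Subgroup.zpowers α) ≠ ⟨α, Subgroup.mem_zpowers α⟩ := fun h =>
    hα1 (congrArg Subtype.val h).symm
  rw [← Equiv.sum_comp SemidirectProduct.equivProd.symm, Fintype.sum_prod_type]
  simp only [univ_zpowers_eq_pair hα, Finset.sum_pair hne, Finset.sum_add_distrib]
  congr 1
  refine Finset.sum_congr rfl fun g _ => congrArg f ?_
  ext <;> simp [twistElement, SemidirectProduct.equivProd]

instance finite_extGroup [Finite G] : Finite (ExtGroup α) :=
  Finite.of_equiv _ SemidirectProduct.equivProd.symm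

theorem card_extGroup [Finite G] (hα : α ^ 2 = 1) (hα1 : α ≠ 1) :
    Nat.card (ExtGroup α) = 2 * Nat.card G := by
  let _ := Fintype.ofFinite G
  let _ := Fintype.ofFinite (ExtGroup α)
  have h := sum_extGroup hα hα1 fun _ => 1
  simp only [Finset.sum_const, Finset.card_univ, smul_eq_mul, mul_one] at h
  rw [Nat.card_eq_fintype_card, Nat.card_eq_fintype_card, h, two_mul]

theorem inl_mul_twistElement_mul_self (hα : α ^ 2 = 1) (g : G) :
    SemidirectProduct.inl g * twistElement α * (SemidirectProduct.inl g * twistElement α) =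
      SemidirectProduct.inl (g * α g) := by
  have hαα : α * α = 1 := by rw [← sq, hα]
  ext
  · simp [twistElement]
  · simp [twistElement, hαα]

theorem inducedChar_eq_zero {x : ExtGroup α} (hx : x.right ≠ 1) : inducedChar χ α x = 0 := by
  have hconj (y : ExtGroup α) : (y * x * y⁻¹).right ≠ 1 := by
    simpa [conj_eq_one_iff] using hx
  simp only [inducedChar, hconj, if_false, finsum_zero, mul_zero]

theorem inducedChar_inl [Finite G] (hχ : IsIrrChar χ) (hα : α ^ 2 = 1) (hα1 : α ≠ 1) (g : G) :
    inducedChar χ α (SemidirectProduct.inl g) = χ g + χ (α g) := by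
  let _ := Fintype.ofFinite G
  let _ := Fintype.ofFinite (ExtGroup α)
  have hG : (Nat.card G : ℂ) ≠ 0 := Nat.cast_ne_zero.2 Nat.card_pos.ne'
  have hsummand (y : ExtGroup α) : χ (y * SemidirectProduct.inl g * y⁻¹).left =
      χ ((y.right : MulAut G) g) := by
    rw [← hχ.apply_conj ((y.right : MulAut G) g) y.left]
    simp [mul_assoc]
  have hright (y : ExtGroup α) : (y * SemidirectProduct.inl g * y⁻¹).right = 1 := by simp
  simp only [inducedChar, hright, if_true, hsummand, finsum_eq_sum_of_fintype]
  rw [inv_mul_eq_iff_eq_mul₀ hG, sum_extGroup hα hα1]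
  simp [twistElement, mul_add]

variable [Fintype G]

theorem sum_apply_mul_self_eq_zero (hχ : IsIrrChar χ) (hO : IndicatorO χ) :
    ∑ g, χ (g * g) = 0 := by
  obtain ⟨n, τ, -, hτ⟩ := id hχ
  have h := sum_character_mul_twist_eq_zero (ρ := τ) (α := 1)
    (by simpa only [MulAut.one_apply, hτ _] using hχ.sum_sq_eq_zero hO)
  simpa only [MulAut.one_apply, hτ _] using h

omit [Fintype G] in
theorem isAbsIrreducible_of_affords_inducedChar [Finite G] (hχ : IsIrrChar χ) (hO : IndicatorO χ)
    (hα : α ^ 2 = 1) (hα1 : α ≠ 1) (hχα : ∀ g, χ (α g) = conj (χ g)) [Fintype (ExtGroup α)]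
    {n : ℕ} {π : Representation ℂ (ExtGroup α) (Fin n → ℂ)} (hπ : Affords (inducedChar χ α) π) :
    IsAbsIrreducible π := by
  have := Fintype.ofFinite G
  have hzero (g : G) : inducedChar χ α (SemidirectProduct.inl g * twistElement α) = 0 :=
    inducedChar_eq_zero fun h => hα1 (by simpa [twistElement] using h)
  have hprod (g : G) : (χ g + χ (α g)) * (χ g⁻¹ + χ (α g⁻¹)) =
      χ g * χ g⁻¹ + χ g * χ g + (χ g⁻¹ * χ g⁻¹ + χ g⁻¹ * χ g) := by
    simp only [hχα, ← hχ.apply_inv, inv_inv]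
    ring
  have hsq := hχ.sum_sq_eq_zero hO
  have hsq_inv := (Equiv.sum_comp (Equiv.inv G) fun g => χ g * χ g).trans hsq
  simp only [Equiv.inv_apply] at hsq_inv
  simp only [IsAbsIrreducible, hπ _]
  rw [sum_extGroup hα hα1, card_extGroup hα hα1]
  simp only [hzero, zero_mul, Finset.sum_const_zero, add_zero, ← map_inv,
    inducedChar_inl hχ hα hα1, hprod, Finset.sum_add_distrib, hsq, hsq_inv, zero_add,
    mul_comm (χ _⁻¹), hχ.sum_mul_inv]
  push_cast
  ring

theorem sum_apply_mul_twist_of_indicatorPlus (hχ : IsIrrChar χ) (hO : IndicatorO χ)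
    (hα : α ^ 2 = 1) (hχα : ∀ g, χ (α g) = conj (χ g)) (hplus : IndicatorPlus (inducedChar χ α)) :
    ∑ g, χ (g * α g) = Nat.card G := by
  let _ := Fintype.ofFinite (ExtGroup α)
  have hα1 : α ≠ 1 := by
    rintro rfl
    obtain ⟨g, hg⟩ := hχ.exists_apply_ne hO hχα
    exact hg rfl
  obtain ⟨-, n, π, hπ, B, hsymm, hnd, hinv⟩ := hplus
  have hirr := isAbsIrreducible_of_affords_inducedChar hχ hO hα hα1 hχα hπ
  have hn : Nontrivial (Fin n → ℂ) :=
    Module.nontrivial_of_finrank_pos (R := ℂ) (Nat.pos_of_ne_zero hirr.finrank_ne_zero)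
  have hflip : B.flip = (1 : ℂ) • B := by
    rw [one_smul]
    exact LinearMap.ext₂ fun v w => hsymm.eq w v
  have hsum := TwistedInvariant.sum_character_mul_twist (α := 1) (fun g v w => hinv g v w) hirr
    hnd.ne_zero hflip
  have hsq_twist : ∑ g, χ (α (g * g)) = 0 := by
    rw [← sum_apply_mul_self_eq_zero hχ hO]
    simp only [map_mul]
    exact Equiv.sum_comp α.toEquiv fun g => χ (g * g)
  have hcomm (g : G) : χ (α (g * α g)) = χ (g * α g) := by
    rw [map_mul, apply_apply_of_sq_eq_one hα, hχ.apply_mul_comm]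
  simp only [hπ _, MulAut.one_apply, card_extGroup hα hα1, one_mul] at hsum
  rw [sum_extGroup hα hα1] at hsum
  simp only [← map_mul, inl_mul_twistElement_mul_self hα, inducedChar_inl hχ hα hα1, hcomm,
    Finset.sum_add_distrib, sum_apply_mul_self_eq_zero hχ hO, hsq_twist] at hsum
  push_cast at hsum
  linear_combination hsum / 2

end InducedCharacter

section QuadraticAlgebras

open IsDedekindDomain

theorem formallyUnramified_of_sqrt {R S T : Type*} [CommRing R] [CommRing S] [CommRing T]
    [Algebra R S] [Algebra S T] [Algebra R T] [IsScalarTower R S T] (M : Submonoid S)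
    [IsLocalization M T] {y : S} {r : R} (hy : y ^ 2 = algebraMap R S r)
    (h2y : IsUnit (algebraMap S T (2 * y)))
    (hS : ∀ x : S, ∃ t p q : R, IsUnit (algebraMap R T t) ∧
      algebraMap R S t * x = algebraMap R S p + algebraMap R S q * y) :
    Algebra.FormallyUnramified R T := by
  let D := KaehlerDifferential.D R T
  have hDy : D (algebraMap S T y) = 0 := by
    have h : D (algebraMap S T y ^ 2) = 0 := by
      rw [← map_pow, hy, ← IsScalarTower.algebraMap_apply, Derivation.map_algebraMap]
    rw [Derivation.leibniz_pow, Nat.add_one_sub_one, pow_one, ← Nat.cast_smul_eq_nsmul T,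
      smul_smul] at h
    refine (h2y.smul_eq_zero).1 ?_
    rwa [map_mul, map_ofNat]
  have hDS (x : S) : D (algebraMap S T x) = 0 := by
    obtain ⟨t, p, q, ht, htx⟩ := hS x
    have h := congrArg (fun z => D (algebraMap S T z)) htx
    simp only [map_mul, map_add, ← IsScalarTower.algebraMap_apply, Derivation.leibniz,
      Derivation.map_algebraMap, smul_zero, add_zero, hDy] at h
    exact ht.smul_eq_zero.1 h
  have hD (z : T) : D z = 0 := by
    obtain ⟨x, s, rfl⟩ := IsLocalization.exists_mk'_eq M z
    have h := congrArg D (IsLocalization.mk'_spec T x s)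
    rw [Derivation.leibniz, hDS, hDS, smul_zero, zero_add] at h
    exact (IsLocalization.map_units T s).smul_eq_zero.1 h
  have hrange : Set.range D ⊆ {0} := Set.range_subset_iff.2 hD
  refine ⟨subsingleton_of_forall_eq 0 fun ω => ?_⟩
  have hω : ω ∈ Submodule.span T (Set.range D) := by
    rw [KaehlerDifferential.span_range_derivation]
    exact Submodule.mem_top
  simpa using Submodule.span_mono hrange hω

theorem exists_mul_sq_eq_algebraMap {R K : Type*} [CommRing R] [IsDedekindDomain R] [Field K]
    [Algebra R K] [IsFractionRing R K] (v : HeightOneSpectrum R) {d : K} (hd : d ≠ 0)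
    (hv : IsSquare (v.valuation K d)) :
    ∃ (s : K) (d' : R), d' ∉ v.asIdeal ∧ d * s ^ 2 = algebraMap R K d' := by
  obtain ⟨w, hw⟩ := hv
  obtain ⟨t, ht⟩ := v.valuation_surjective K w⁻¹
  have hw0 : w ≠ 0 := by
    rintro rfl
    rw [mul_zero, map_eq_zero] at hw
    exact hd hw
  have hunit : v.valuation K (d * t ^ 2) = 1 := by
    rw [map_mul, map_pow, hw, ht]
    field_simp
  obtain ⟨a, b, hab⟩ := v.exists_primeCompl_mul_eq_of_integer (d * t ^ 2) hunit.le
  refine ⟨t * algebraMap R K b, a * b, ?_, ?_⟩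
  · rw [← v.valuation_eq_one_iff_notMem (K := K)]
    have hb := (v.valuation_eq_one_iff_notMem (K := K)).2 b.2
    rw [map_mul, ← hab, map_mul, map_mul, hunit, hb]
    simp
  · rw [map_mul, ← hab]
    ring

variable {K : Type*} [Field K] {d : K}

theorem root_sq_eq : (AdjoinRoot.root _ : quadAlgebra d) ^ 2 = algebraMap K (quadAlgebra d) d := by
  have h := AdjoinRoot.eval₂_root (Polynomial.X ^ 2 - Polynomial.C d : K[X])
  simp only [Polynomial.eval₂_sub, Polynomial.eval₂_pow, Polynomial.eval₂_X,
    Polynomial.eval₂_C] at h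
  exact sub_eq_zero.1 h

theorem exists_eq_add_mul_root (x : quadAlgebra d) :
    ∃ u w : K, x = algebraMap K (quadAlgebra d) u + algebraMap K (quadAlgebra d) w *
      AdjoinRoot.root _ := by
  have hmonic := Polynomial.monic_X_pow_sub_C d two_ne_zero
  obtain ⟨f, rfl⟩ := AdjoinRoot.mk_surjective x
  have hdeg : (f %ₘ (Polynomial.X ^ 2 - Polynomial.C d)).natDegree ≤ 1 := by
    have h := Polynomial.natDegree_modByMonic_lt f hmonic
      (ne_of_apply_ne Polynomial.natDegree <| by
        rw [Polynomial.natDegree_X_pow_sub_C, Polynomial.natDegree_one]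
        exact two_ne_zero)
    rw [Polynomial.natDegree_X_pow_sub_C] at h
    exact Nat.le_of_lt_succ h
  obtain ⟨w, u, hwu⟩ := Polynomial.exists_eq_X_add_C_of_natDegree_le_one hdeg
  refine ⟨u, w, ?_⟩
  rw [← AdjoinRoot.mk_leftInverse hmonic (AdjoinRoot.mk _ f), AdjoinRoot.modByMonicHom_mk, hwu,
    map_add, map_mul, add_comm]
  rfl

/-- The conjugation of `K[X]/(X² - d)`, sending the class of `X` to its negative. -/
def quadConj (d : K) : quadAlgebra d →ₐ[K] quadAlgebra d :=
  AdjoinRoot.liftAlgHom _ (Algebra.ofId K (quadAlgebra d)) (-AdjoinRoot.root _) <| by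
    simp only [Polynomial.eval₂_sub, Polynomial.eval₂_pow, Polynomial.eval₂_X,
      Polynomial.eval₂_C, neg_sq, root_sq_eq]
    exact sub_self _

theorem quadConj_add_mul_root (u w : K) :
    quadConj d (algebraMap K (quadAlgebra d) u + algebraMap K (quadAlgebra d) w *
      AdjoinRoot.root _) = algebraMap K (quadAlgebra d) u - algebraMap K (quadAlgebra d) w *
      AdjoinRoot.root _ := by
  rw [map_add, map_mul, AlgHom.commutes, AlgHom.commutes, quadConj, AdjoinRoot.liftAlgHom_root,
    mul_neg]
  exact (sub_eq_add_neg _ _).symm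

variable {R : Type*} [CommRing R] [Algebra R K] {s : K} {d' : R}

theorem sq_mul_root_eq (hs : d * s ^ 2 = algebraMap R K d') :
    (algebraMap K (quadAlgebra d) s * AdjoinRoot.root _) ^ 2 =
      algebraMap R (quadAlgebra d) d' := by
  rw [mul_pow, root_sq_eq, ← map_pow, ← map_mul, mul_comm, hs, ← IsScalarTower.algebraMap_apply]

theorem isIntegral_mul_root (hs : d * s ^ 2 = algebraMap R K d') :
    IsIntegral R (algebraMap K (quadAlgebra d) s * AdjoinRoot.root _ : quadAlgebra d) :=
  IsIntegral.of_pow two_pos <| by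
    rw [sq_mul_root_eq hs]
    exact isIntegral_algebraMap

theorem exists_eq_algebraMap_of_isIntegral [IsIntegrallyClosed R] [IsFractionRing R K] {k : K}
    (hk : IsIntegral R (algebraMap K (quadAlgebra d) k)) : ∃ r : R, algebraMap R K r = k := by
  have : Nontrivial (quadAlgebra d) := AdjoinRoot.nontrivial _ (by
    rw [Polynomial.degree_X_pow_sub_C two_pos]
    exact two_ne_zero)
  exact IsIntegrallyClosed.isIntegral_iff.1
    ((isIntegral_algebraMap_iff (algebraMap K (quadAlgebra d)).injective).1 hk)

-- For `x = u + w θ` integral, `x + x̄ = 2 u` and `s θ (x - x̄) = 2 w s d` lie in `R`.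
theorem exists_two_mul_eq_of_isIntegral [IsIntegrallyClosed R] [IsFractionRing R K]
    (hs : d * s ^ 2 = algebraMap R K d') {x : quadAlgebra d} (hx : IsIntegral R x) :
    ∃ p q : R, algebraMap R (quadAlgebra d) (2 * d') * x = algebraMap R (quadAlgebra d) (d' * p) +
      algebraMap R (quadAlgebra d) q * (algebraMap K (quadAlgebra d) s * AdjoinRoot.root _) := by
  obtain ⟨u, w, huw⟩ := exists_eq_add_mul_root x
  have hconj := quadConj_add_mul_root (d := d) u w
  rw [← huw] at hconj
  have hxc : IsIntegral R (quadConj d x) := hx.map (quadConj d)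
  obtain ⟨p, hp⟩ := exists_eq_algebraMap_of_isIntegral (R := R) (d := d) (k := 2 * u) <| by
    have h : algebraMap K (quadAlgebra d) (2 * u) = x + quadConj d x := by
      rw [hconj, huw, map_mul, map_ofNat]
      ring
    exact h ▸ hx.add hxc
  obtain ⟨q, hq⟩ := exists_eq_algebraMap_of_isIntegral (R := R) (d := d) (k := 2 * w * s * d) <| by
    have h : algebraMap K (quadAlgebra d) (2 * w * s * d) =
        algebraMap K (quadAlgebra d) s * AdjoinRoot.root _ * (x - quadConj d x) := by
      rw [hconj, huw, map_mul, map_mul, map_mul, ← root_sq_eq, map_ofNat]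
      ring
    exact h ▸ (isIntegral_mul_root hs).mul (hx.sub hxc)
  refine ⟨p, q, ?_⟩
  simp only [IsScalarTower.algebraMap_apply R K (quadAlgebra d), hq, huw, map_mul, map_ofNat, hp,
    ← hs, map_pow]
  ring

end QuadraticAlgebras

section Ramification

open NumberField IsDedekindDomain

variable {K : Type*} [Field K] [NumberField K]

theorem not_ramifiesIn_of_isSquare_valuation (v : HeightOneSpectrum (𝓞 K)) {d : K} (hd : d ≠ 0)
    (h2 : (2 : 𝓞 K) ∉ v.asIdeal) (hv : IsSquare (v.valuation K d)) :
    ¬ RamifiesIn v (quadAlgebra d) := by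
  rw [RamifiesIn, not_not]
  intro 𝔓 _ hover
  obtain ⟨s, d', hd', hs⟩ := exists_mul_sq_eq_algebraMap v hd hv
  let y : integralClosure (𝓞 K) (quadAlgebra d) := ⟨_, isIntegral_mul_root hs⟩
  have hy : y ^ 2 = algebraMap (𝓞 K) _ d' := Subtype.ext (sq_mul_root_eq hs)
  have hunit {r : 𝓞 K} (hr : r ∉ v.asIdeal) :
      IsUnit (algebraMap (𝓞 K) (Localization.AtPrime 𝔓) r) := by
    rw [IsScalarTower.algebraMap_apply (𝓞 K) (integralClosure (𝓞 K) (quadAlgebra d))]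
    refine IsLocalization.map_units _ (⟨_, fun h => hr ?_⟩ : 𝔓.primeCompl)
    rwa [Ideal.over_def 𝔓 v.asIdeal, Ideal.under_def, Ideal.mem_comap]
  refine formallyUnramified_of_sqrt 𝔓.primeCompl hy ?_ fun x => ?_
  · have hunit_y := hunit hd'
    rw [IsScalarTower.algebraMap_apply (𝓞 K) (integralClosure (𝓞 K) (quadAlgebra d)), ← hy,
      map_pow, isUnit_pow_iff two_ne_zero] at hunit_y
    have hunit_two := hunit h2
    rw [map_ofNat] at hunit_two
    rw [map_mul, map_ofNat]
    exact hunit_two.mul hunit_y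
  · obtain ⟨p, q, hpq⟩ := exists_two_mul_eq_of_isIntegral hs x.2
    exact ⟨2 * d', d' * p, q, hunit fun h => (v.isPrime.mem_or_mem h).elim h2 hd',
      Subtype.ext hpq⟩

end Ramification

section CyclotomicFields

open NumberField IsDedekindDomain

theorem exists_primesOver_ramificationIdx'_eq_one {K E : Type*} [Field K] [NumberField K]
    [Field E] [NumberField E] [Algebra K E] {N : ℕ} [NeZero N] [IsCyclotomicExtension {N} ℚ E]
    (v : HeightOneSpectrum (𝓞 K)) (hN : (N : 𝓞 K) ∉ v.asIdeal) :
    ∃ 𝔓 ∈ v.asIdeal.primesOver (𝓞 E), Ideal.ramificationIdx' v.asIdeal 𝔓 = 1 := by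
  obtain ⟨⟨𝔓, h𝔓, hover⟩⟩ := v.asIdeal.nonempty_primesOver (S := 𝓞 E)
  refine ⟨𝔓, ⟨h𝔓, hover⟩, ?_⟩
  let p := Ideal.absNorm (v.asIdeal.under ℤ)
  have : v.asIdeal.LiesOver (Ideal.span {(p : ℤ)}) := Int.liesOver_span_absNorm _
  have : NeZero v.asIdeal := ⟨v.ne_bot⟩
  have : Fact p.Prime := ⟨Nat.absNorm_under_prime v.asIdeal⟩
  have hpN : ¬ p ∣ N := fun h => hN <| by
    simpa using (Int.cast_mem_ideal_iff (I := v.asIdeal) (d := (N : ℤ))).2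
      (Int.natCast_dvd_natCast.2 h)
  have hp0 : Ideal.span {(p : ℤ)} ≠ ⊥ := by
    rw [Ne, Ideal.span_singleton_eq_bot]
    exact_mod_cast (Fact.out : p.Prime).ne_zero
  have : 𝔓.LiesOver (Ideal.span {(p : ℤ)}) := Ideal.LiesOver.trans 𝔓 v.asIdeal _
  have he : Ideal.ramificationIdx' (Ideal.span {(p : ℤ)}) 𝔓 = 1 := by
    rw [Ideal.ramificationIdx'_eq_ramificationIdx _ _ hp0]
    exact IsCyclotomicExtension.Rat.ramificationIdx_eq_of_not_dvd p E 𝔓 hpN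
  rw [Ideal.ramificationIdx'_algebra_tower' _ v.asIdeal 𝔓] at he
  exact Nat.eq_one_of_mul_eq_one_left he

theorem exists_valuation_extending_of_le_cyclotomic {K L E : Type*} [Field K] [NumberField K]
    [Field L] [NumberField L] [Field E] [NumberField E] [Algebra K L] {N : ℕ} [NeZero N]
    [IsCyclotomicExtension {N} ℚ E] (ι : L →+* E)
    (v : HeightOneSpectrum (𝓞 K)) (hN : (N : 𝓞 K) ∉ v.asIdeal) :
    ∃ w : HeightOneSpectrum (𝓞 L), ∀ x : K, w.valuation L (algebraMap K L x) = v.valuation K x := by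
  let _ : Algebra L E := ι.toAlgebra
  let _ : Algebra K E := (ι.comp (algebraMap K L)).toAlgebra
  have : IsScalarTower K L E := IsScalarTower.of_algebraMap_eq fun _ => rfl
  obtain ⟨𝔓, ⟨_, _⟩, he⟩ := exists_primesOver_ramificationIdx'_eq_one (E := E) v hN
  have : (𝔓.under (𝓞 L)).LiesOver v.asIdeal := inferInstance
  let w : HeightOneSpectrum (𝓞 L) :=
    ⟨𝔓.under (𝓞 L), inferInstance, Ideal.ne_bot_of_liesOver_of_ne_bot v.ne_bot _⟩
  have : w.asIdeal.LiesOver v.asIdeal := ‹(𝔓.under (𝓞 L)).LiesOver v.asIdeal›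
  rw [Ideal.ramificationIdx'_algebra_tower' _ w.asIdeal 𝔓] at he
  refine ⟨w, fun x => ?_⟩
  rw [← v.valuation_liesOver L w x, Nat.eq_one_of_mul_eq_one_right he, pow_one]

theorem isCyclotomicExtension_adjoin_simple {N : ℕ} [NeZero N] {E : Type*} [Field E] [CharZero E]
    {ζ : E} (hζ : IsPrimitiveRoot ζ N) :
    IsCyclotomicExtension {N} ℚ (IntermediateField.adjoin ℚ {ζ}) := by
  change IsCyclotomicExtension {N} ℚ (IntermediateField.adjoin ℚ {ζ}).toSubalgebra
  rw [IntermediateField.adjoin_simple_toSubalgebra_of_isAlgebraic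
    (hζ.isIntegral (NeZero.pos N)).tower_top.isAlgebraic]
  exact hζ.adjoin_isCyclotomicExtension ℚ

section CharacterField

variable {G : Type*} [Group G] [Finite G] {χ : G → ℂ}

theorem charField_le_adjoin_root {n : ℕ} {τ : Representation ℂ G (Fin n → ℂ)}
    (hτ : Affords χ τ) {ζ : ℂ} (hζ : IsPrimitiveRoot ζ (Nat.card G)) :
    charField χ ≤ IntermediateField.adjoin ℚ {ζ} := by
  have : NeZero (Nat.card G) := ⟨Nat.card_pos.ne'⟩
  refine IntermediateField.adjoin_le_iff.2 ?_
  rintro _ ⟨g, rfl⟩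
  obtain ⟨s, m, hs, hsum⟩ := exists_character_pow_eq_sum τ g
  rw [← hτ g, ← pow_one g, hsum 1]
  refine sum_mem fun μ hμ => mul_mem (natCast_mem _ _) (pow_mem ?_ _)
  obtain ⟨i, -, rfl⟩ := hζ.eq_pow_of_pow_eq_one (hs μ hμ)
  exact pow_mem (IntermediateField.mem_adjoin_simple_self ℚ ζ) i

theorem IsIrrChar.exists_cyclotomic_embedding (hχ : IsIrrChar χ) :
    ∃ E : IntermediateField ℚ ℂ, NumberField E ∧ IsCyclotomicExtension {Nat.card G} ℚ E ∧
      charField χ ≤ E := by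
  obtain ⟨n, τ, -, hτ⟩ := hχ
  have : NeZero (Nat.card G) := ⟨Nat.card_pos.ne'⟩
  have hζ := Complex.isPrimitiveRoot_exp (Nat.card G) Nat.card_pos.ne'
  have hcyc := isCyclotomicExtension_adjoin_simple hζ
  exact ⟨_, IsCyclotomicExtension.numberField {Nat.card G} ℚ _, hcyc,
    charField_le_adjoin_root hτ hζ⟩

theorem IsIrrChar.numberField_charField (hχ : IsIrrChar χ) : NumberField (charField χ) := by
  obtain ⟨E, _, -, hle⟩ := hχ.exists_cyclotomic_embedding
  have : FiniteDimensional ℚ (charField χ) := FiniteDimensional.of_injective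
    (IntermediateField.inclusion hle).toLinearMap (IntermediateField.inclusion_injective hle)
  exact { to_finiteDimensional := this }

theorem IsIrrChar.numberField_realField (hχ : IsIrrChar χ) : NumberField (realField χ) := by
  have := hχ.numberField_charField
  have : FiniteDimensional ℚ (realField χ) := FiniteDimensional.of_injective
    (realField χ).subtype.toRatAlgHom.toLinearMap Subtype.val_injective
  exact { to_finiteDimensional := this }

theorem IsIrrChar.exists_valuation_extending (hχ : IsIrrChar χ) [NumberField (charField χ)]
    [NumberField (realField χ)] (v : HeightOneSpectrum (𝓞 (realField χ)))
    (hN : (Nat.card G : 𝓞 (realField χ)) ∉ v.asIdeal) :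
    ∃ w : HeightOneSpectrum (𝓞 (charField χ)), ∀ x : realField χ,
      w.valuation (charField χ) (x : charField χ) = v.valuation (realField χ) x := by
  obtain ⟨E, _, _, hle⟩ := hχ.exists_cyclotomic_embedding
  have : NeZero (Nat.card G) := ⟨Nat.card_pos.ne'⟩
  exact exists_valuation_extending_of_le_cyclotomic
    (IntermediateField.inclusion hle).toRingHom v hN

end CharacterField

end CyclotomicFields

section IntegralForms

open Matrix

variable {L : Type*} [Field L] {V : Type*} [AddCommGroup V] [Module L V]

theorem repr_extendOfIsLattice {R : Type*} [CommRing R] [Algebra R L] [IsFractionRing R L]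
    [Module R V] [IsScalarTower R L V] {ι : Type*} {M : Submodule R V} [Submodule.IsLattice L M]
    (b : Module.Basis ι R M) (x : M) (i : ι) :
    (b.extendOfIsLattice L).repr (x : V) i = algebraMap R L (b.repr x i) := by
  classical
  have h : ((b.extendOfIsLattice L).coord i).restrictScalars R ∘ₗ M.subtype =
      Algebra.linearMap R L ∘ₗ b.coord i := b.ext fun j => by
    change (b.extendOfIsLattice L).repr (b j : V) i = algebraMap R L (b.repr (b j) i)
    rw [← Module.Basis.extendOfIsLattice_apply L b j, Module.Basis.repr_self,
      Module.Basis.repr_self, Finsupp.single_apply, Finsupp.single_apply,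
      apply_ite (algebraMap R L), map_one, map_zero]
  exact LinearMap.congr_fun h x

theorem span_orbit_invariant {R G : Type*} [CommRing R] [Algebra R L] [Module R V]
    [IsScalarTower R L V] [Group G] (ρ : Representation L G V) {ι : Type*} (v : ι → V) (g : G)
    {x : V} (hx : x ∈ Submodule.span R (Set.range fun y : G × ι => ρ y.1 (v y.2))) :
    ρ g x ∈ Submodule.span R (Set.range fun y : G × ι => ρ y.1 (v y.2)) := by
  suffices h : Submodule.span R (Set.range fun y : G × ι => ρ y.1 (v y.2)) ≤
      (Submodule.span R (Set.range fun y : G × ι => ρ y.1 (v y.2))).comap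
        ((ρ g).restrictScalars R) from h hx
  rw [Submodule.span_le]
  rintro _ ⟨⟨h, i⟩, rfl⟩
  exact Submodule.subset_span ⟨(g * h, i), by simp⟩

theorem exists_basis_integral (O : Subring L) [IsPrincipalIdealRing O] [IsFractionRing O L]
    [FiniteDimensional L V] {G : Type*} [Group G] [Finite G] (ρ : Representation L G V) :
    ∃ b : Module.Basis (Fin (Module.finrank L V)) L V,
      ∀ g i j, LinearMap.toMatrix b b (ρ g) i j ∈ O := by
  let b₀ := Module.finBasis L V
  let M : Submodule O V := Submodule.span O (Set.range fun y : G × _ => ρ y.1 (b₀ y.2))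
  have : Submodule.IsLattice L M := by
    refine ⟨Submodule.fg_span (Set.finite_range _), eq_top_iff.2 ?_⟩
    rw [← b₀.span_eq]
    refine Submodule.span_mono ?_
    rintro _ ⟨i, rfl⟩
    exact Submodule.subset_span ⟨(1, i), by simp⟩
  let bO := Module.Free.chooseBasis O M
  have hcard : Fintype.card (Module.Free.ChooseBasisIndex O M) = Module.finrank L V :=
    (Module.finrank_eq_card_basis (bO.extendOfIsLattice L)).symm
  refine ⟨(bO.extendOfIsLattice L).reindex (Fintype.equivFinOfCardEq hcard), fun g i j => ?_⟩
  rw [LinearMap.toMatrix_apply, Module.Basis.repr_reindex_apply, Module.Basis.reindex_apply,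
    Module.Basis.extendOfIsLattice_apply]
  exact repr_extendOfIsLattice bO ⟨_, span_orbit_invariant ρ b₀ g (bO _).2⟩ _ ▸ Subtype.property _

variable {n : Type*} [Fintype n] [DecidableEq n]

theorem det_mem_subring {R : Type*} [CommRing R] (O : Subring R) (M : Matrix n n R)
    (hM : ∀ i j, M i j ∈ O) : M.det ∈ O :=
  (O.subtype.map_det (Matrix.of fun i j => ⟨M i j, hM i j⟩)).symm ▸ Subtype.property _

theorem exists_valuation_det_eq_pow {Γ₀ : Type*} [LinearOrderedCommGroupWithZero Γ₀]
    (val : Valuation L Γ₀) {S : Matrix n n L} (hS : S.det ≠ 0)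
    (hprod : ∀ i j k l, val (S⁻¹ k j * S i l) ≤ 1) :
    ∃ c, val S.det = val c ^ Fintype.card n := by
  rcases isEmpty_or_nonempty n with _ | _
  · exact ⟨1, by simp⟩
  obtain ⟨⟨i₀, j₀⟩, hmax⟩ := Finite.exists_max fun x : n × n => val (S x.1 x.2)
  set c := S i₀ j₀
  refine ⟨c, ?_⟩
  have hdet_le {M : Matrix n n L} (hM : ∀ i j, val (M i j) ≤ 1) : val M.det ≤ 1 :=
    det_mem_subring val.integer M hM
  have hc : c ≠ 0 := fun h => hS <| by
    have hS0 : S = 0 := Matrix.ext fun i j => val.zero_iff.1 <| le_zero_iff.1 <| by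
      simpa only [h, map_zero] using hmax (i, j)
    rw [hS0, Matrix.det_zero]
  have hle : val (c⁻¹ • S).det ≤ 1 := hdet_le fun i j => by
    rw [Matrix.smul_apply, smul_eq_mul, map_mul, map_inv₀]
    exact inv_mul_le_one_of_le₀ (hmax (i, j)) zero_le
  have hge : val (c • S⁻¹).det ≤ 1 := hdet_le fun i j => by
    rw [Matrix.smul_apply, smul_eq_mul, mul_comm]
    exact hprod _ _ _ _
  rw [Matrix.det_smul, map_mul, map_pow, map_inv₀, inv_pow] at hle
  rw [Matrix.det_smul, map_mul, map_pow, Matrix.det_nonsing_inv, Ring.inverse_eq_inv',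
    map_inv₀] at hge
  have hvc : 0 < val c := zero_lt_iff.2 (val.ne_zero_iff.2 hc)
  have hvS : 0 < val S.det := zero_lt_iff.2 (val.ne_zero_iff.2 hS)
  exact le_antisymm ((inv_mul_le_one₀ (pow_pos hvc _)).1 hle)
    (by simpa only [one_mul] using (mul_inv_le_iff₀ hvS).1 hge)

variable {G : Type*} [Group G] {ρ : Representation L G V} (b : Module.Basis n L V) {O : Subring L}
  {α : MulAut G} {B : LinearMap.BilinForm L V}

theorem TwistedInvariant.adjoint_toMatrix_apply_mem (hB : TwistedInvariant ρ α B)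
    (hdet : (LinearMap.BilinForm.toMatrix b B).det ≠ 0)
    (hb : ∀ g i j, LinearMap.toMatrix b b (ρ g) i j ∈ O) (g : G) (k l : n) :
    ((LinearMap.BilinForm.toMatrix b B)⁻¹ * (LinearMap.toMatrix b b (ρ g))ᵀ *
      LinearMap.BilinForm.toMatrix b B) k l ∈ O := by
  have hadj : (LinearMap.toMatrix b b (ρ g))ᵀ * LinearMap.BilinForm.toMatrix b B =
      LinearMap.BilinForm.toMatrix b B * LinearMap.toMatrix b b (ρ (α g⁻¹)) := by
    rw [← LinearMap.BilinForm.toMatrix_compLeft, ← LinearMap.BilinForm.toMatrix_compRight]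
    refine congrArg _ (LinearMap.ext₂ fun v w => ?_)
    exact (inv_inv g ▸ hB.apply_right g⁻¹ v w).symm
  rw [Matrix.mul_assoc, hadj, Matrix.nonsing_inv_mul_cancel_left _ _ hdet.isUnit]
  exact hb _ _ _

variable [CharZero L] [FiniteDimensional L V] [Fintype G]

theorem IsAbsIrreducible.mem_span_range_toMatrix (hρ : IsAbsIrreducible ρ)
    (hG : (Nat.card G : L)⁻¹ ∈ O) (hb : ∀ g i j, LinearMap.toMatrix b b (ρ g) i j ∈ O)
    {X : Matrix n n L} (hX : ∀ i j, X i j ∈ O) :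
    X ∈ Submodule.span O (Set.range fun g => LinearMap.toMatrix b b (ρ g)) := by
  have htrace (g : G) : LinearMap.trace L V (Matrix.toLin b b X * ρ g⁻¹) ∈ O := by
    rw [LinearMap.trace_eq_matrix_trace L b, LinearMap.toMatrix_mul, LinearMap.toMatrix_toLin]
    refine sum_mem fun i _ => ?_
    rw [Matrix.diag_apply, Matrix.mul_apply]
    exact sum_mem fun j _ => mul_mem (hX _ _) (hb _ _ _)
  have hfourier := congrArg (LinearMap.toMatrix b b) (hρ.fourier_inversion (Matrix.toLin b b X))
  simp only [LinearMap.toMatrix_toLin, map_smul, map_sum] at hfourier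
  rw [hfourier]
  exact Submodule.smul_mem _ (⟨_, mul_mem (natCast_mem O _) hG⟩ : O) <|
    Submodule.sum_mem _ fun g _ =>
      Submodule.smul_mem _ (⟨_, htrace g⟩ : O) (Submodule.subset_span ⟨g, rfl⟩)

theorem TwistedInvariant.toMatrix_inv_mul_apply_mem (hB : TwistedInvariant ρ α B)
    (hρ : IsAbsIrreducible ρ) (hdet : (LinearMap.BilinForm.toMatrix b B).det ≠ 0)
    (hG : (Nat.card G : L)⁻¹ ∈ O) (hb : ∀ g i j, LinearMap.toMatrix b b (ρ g) i j ∈ O)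
    (i j k l : n) :
    (LinearMap.BilinForm.toMatrix b B)⁻¹ k j * LinearMap.BilinForm.toMatrix b B i l ∈ O := by
  set S := LinearMap.BilinForm.toMatrix b B
  have hadj {X : Matrix n n L}
      (hX : X ∈ Submodule.span O (Set.range fun g => LinearMap.toMatrix b b (ρ g))) (k l : n) :
      (S⁻¹ * Xᵀ * S) k l ∈ O := by
    induction hX using Submodule.span_induction with
    | zero => simp
    | add X Y _ _ hX hY =>
      rw [Matrix.transpose_add, Matrix.mul_add, Matrix.add_mul]
      exact add_mem hX hY
    | smul c X _ hX =>
      rw [Matrix.transpose_smul, Matrix.mul_smul, Matrix.smul_mul]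
      exact mul_mem c.2 hX
    | mem X hX =>
      obtain ⟨g, rfl⟩ := hX
      exact hB.adjoint_toMatrix_apply_mem b hdet hb g k l
  have hsingle := hadj (hρ.mem_span_range_toMatrix b hG hb (X := Matrix.single i j 1) fun a c => by
    rw [Matrix.single_apply]
    split_ifs
    exacts [one_mem O, zero_mem O]) k l
  rwa [Matrix.transpose_single, Matrix.mul_assoc, Matrix.mul_apply, Finset.sum_eq_single j,
    Matrix.single_mul_apply_same, one_mul] at hsingle
  · intro a _ ha
    rw [Matrix.single_mul_apply_of_ne _ _ _ _ _ ha, mul_zero]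
  · simp

theorem TwistedInvariant.exists_isSquare_valuation_det (hB : TwistedInvariant ρ α B)
    (hρ : IsAbsIrreducible ρ) (hB0 : B ≠ 0) {Γ₀ : Type*} [LinearOrderedCommGroupWithZero Γ₀]
    (val : Valuation L Γ₀) [IsPrincipalIdealRing val.valuationSubring]
    (hG : val (Nat.card G : L) = 1) (heven : Even (Module.finrank L V)) :
    ∃ b : Module.Basis (Fin (Module.finrank L V)) L V,
      IsSquare (val (LinearMap.BilinForm.toMatrix b B).det) := by
  have : IsPrincipalIdealRing val.valuationSubring.toSubring :=
    ‹IsPrincipalIdealRing val.valuationSubring›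
  have : IsFractionRing val.valuationSubring.toSubring L :=
    inferInstanceAs (IsFractionRing val.valuationSubring L)
  obtain ⟨b, hb⟩ := exists_basis_integral val.valuationSubring.toSubring ρ
  have hdet : (LinearMap.BilinForm.toMatrix b B).det ≠ 0 :=
    (LinearMap.BilinForm.nondegenerate_iff_det_ne_zero b).1 (hB.nondegenerate hρ hB0)
  have hG' : (Nat.card G : L)⁻¹ ∈ val.valuationSubring.toSubring := by
    refine (val.mem_valuationSubring_iff _).2 ?_
    rw [map_inv₀, hG, inv_one]
  obtain ⟨c, hc⟩ := exists_valuation_det_eq_pow val hdet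
    (hB.toMatrix_inv_mul_apply_mem b hρ hdet hG' hb)
  rw [Fintype.card_fin] at hc
  exact ⟨b, hc ▸ heven.isSquare_pow _⟩

end IntegralForms

section ConjugateTwists

variable {L : Type*} [Field L] {G V : Type*} [Group G] [AddCommGroup V] [Module L V]
  {K : Subfield L} {ρ : Representation L G V} {α : MulAut G}

theorem sub_mul_sub_mem_fixedSpan (hα : α ^ 2 = 1) (x g : G) :
    (ρ x - ρ (α x)) * (ρ g - ρ (α g)) ∈ fixedSpan K ρ α := by
  have h : (ρ x - ρ (α x)) * (ρ g - ρ (α g)) =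
      (ρ (x * g) + ρ (α (x * g))) - (ρ (x * α g) + ρ (α (x * α g))) := by
    simp only [map_mul, apply_apply_of_sq_eq_one hα]
    noncomm_ring
  exact h ▸ sub_mem (Submodule.subset_span ⟨_, rfl⟩) (Submodule.subset_span ⟨_, rfl⟩)

variable [Fintype G]

namespace IsAbsIrreducible

variable [CharZero L] [FiniteDimensional L V]

theorem eq_zero_of_forall_trace_mul (hρ : IsAbsIrreducible ρ) {x : Module.End L V}
    (hx : ∀ y, LinearMap.trace L V (x * y) = 0) : x = 0 := by
  rw [hρ.fourier_inversion x]
  simp only [hx, zero_smul, Finset.sum_const_zero, smul_zero]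

theorem sum_conj_sub_apply_conj (hρ : IsAbsIrreducible ρ) (g : G) :
    ∑ h, (ρ (h * g * h⁻¹) - ρ (α (h * g * h⁻¹))) = (Nat.card G * (Module.finrank L V : L)⁻¹ *
      (ρ.character g - ρ.character (α g))) • 1 := by
  have hconj (x : G) : ∑ h, ρ (h * x * h⁻¹) =
      (Nat.card G * (Module.finrank L V : L)⁻¹ * ρ.character x) • 1 := by
    simp only [map_mul, hρ.sum_conj_eq_smul_one, Representation.character]
  have htwist : ∑ h, ρ (α (h * g * h⁻¹)) = ∑ h, ρ (h * α g * h⁻¹) :=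
    Fintype.sum_equiv α.toEquiv _ _ fun h => by
      change _ = ρ (α h * α g * (α h)⁻¹)
      rw [map_mul α, map_mul α, map_inv α]
  rw [Finset.sum_sub_distrib, htwist, hconj, hconj, mul_sub, sub_smul]

-- Multiply `ρ g - ρ (α g)` by the central element `∑ h, ρ (h x h⁻¹) - ρ (α (h x h⁻¹))`.
theorem character_sub_smul_sub_mem_fixedSpan (hρ : IsAbsIrreducible ρ) (hα : α ^ 2 = 1)
    (x g : G) :
    (ρ.character x - ρ.character (α x)) • (ρ g - ρ (α g)) ∈ fixedSpan K ρ α := by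
  have hn : (Module.finrank L V : L) ≠ 0 := Nat.cast_ne_zero.2 hρ.finrank_ne_zero
  have hG : (Nat.card G : L) ≠ 0 := Nat.cast_ne_zero.2 Nat.card_pos.ne'
  have h : (ρ.character x - ρ.character (α x)) • (ρ g - ρ (α g)) =
      ((Module.finrank L V : K) * (Nat.card G : K)⁻¹) •
        ∑ h, (ρ (h * x * h⁻¹) - ρ (α (h * x * h⁻¹))) * (ρ g - ρ (α g)) := by
    rw [← Finset.sum_mul, hρ.sum_conj_sub_apply_conj, smul_mul_assoc, one_mul, Subfield.smul_def,
      smul_smul]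
    congr 1
    push_cast
    field_simp
  exact h ▸ Submodule.smul_mem _ _ (sum_mem fun h _ => sub_mul_sub_mem_fixedSpan hα _ g)

end IsAbsIrreducible

/-- The field `K` is the fixed field of the involution `c` of `L`, and `α` is an automorphism with
`α² = 1` taking the character of the absolutely irreducible representation `ρ` over `L` to its
conjugate under `c`, which is a different character. -/
structure ConjugateTwist (K : Subfield L) (c : L →+* L) (ρ : Representation L G V)
    (α : MulAut G) : Prop where
  mem_iff : ∀ x, x ∈ K ↔ c x = x
  involutive : Function.Involutive c
  isAbsIrreducible : IsAbsIrreducible ρ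
  sq_eq_one : α ^ 2 = 1
  conj_character : ∀ g, c (ρ.character g) = ρ.character (α g)
  exists_character_ne : ∃ g, ρ.character (α g) ≠ ρ.character g

namespace ConjugateTwist

variable {c : L →+* L} (D : ConjugateTwist K c ρ α)
include D

theorem conj_character_sub (x : G) : c (ρ.character x - ρ.character (α x)) =
    -(ρ.character x - ρ.character (α x)) := by
  rw [map_sub, D.conj_character, D.conj_character, apply_apply_of_sq_eq_one D.sq_eq_one, neg_sub]

theorem exists_conj_eq_neg : ∃ δ : L, δ ≠ 0 ∧ c δ = -δ := by
  obtain ⟨x, hx⟩ := D.exists_character_ne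
  exact ⟨_, sub_ne_zero.2 hx.symm, D.conj_character_sub x⟩

theorem map_eq_self_iff {p : L[X]} :
    p.map c = p ↔ ∃ q : K[X], q.map (algebraMap K L) = p := by
  refine ⟨fun hp => (Polynomial.lifts_iff_coeff_lifts p).2 fun i =>
    ⟨⟨p.coeff i, (D.mem_iff _).2 (by rw [← Polynomial.coeff_map, hp])⟩, rfl⟩, ?_⟩
  rintro ⟨q, rfl⟩
  rw [Polynomial.map_map]
  exact congrArg₂ _ (RingHom.ext fun x => (D.mem_iff x).1 x.2) rfl

theorem trace_mem {a : Module.End L V} (ha : a ∈ fixedSpan K ρ α) :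
    LinearMap.trace L V a ∈ K := by
  suffices h : fixedSpan K ρ α ≤ (Submodule.span K {(1 : L)}).comap
      ((LinearMap.trace L V).restrictScalars K) by
    obtain ⟨k, hk⟩ := Submodule.mem_span_singleton.1 (h ha)
    rw [Subfield.smul_def, smul_eq_mul, mul_one] at hk
    exact hk ▸ k.2
  rw [fixedSpan, Submodule.span_le]
  rintro _ ⟨g, rfl⟩
  have h : ρ.character g + ρ.character (α g) ∈ K := by
    rw [D.mem_iff, map_add, D.conj_character, D.conj_character,
      apply_apply_of_sq_eq_one D.sq_eq_one, add_comm]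
  refine Submodule.mem_span_singleton.2 ⟨⟨_, h⟩, ?_⟩
  rw [Subfield.smul_def, smul_eq_mul, mul_one, LinearMap.coe_restrictScalars, map_add]
  rfl

variable [CharZero L] {δ : L} (hδ : c δ = -δ)
include hδ

theorem inv_smul_sub_mem_fixedSpan [FiniteDimensional L V] (g : G) :
    δ⁻¹ • (ρ g - ρ (α g)) ∈ fixedSpan K ρ α := by
  obtain ⟨x, hx⟩ := D.exists_character_ne
  set ε := ρ.character x - ρ.character (α x)
  have hmem : δ⁻¹ * ε⁻¹ ∈ K := by
    rw [D.mem_iff, map_mul, map_inv₀, map_inv₀, hδ, D.conj_character_sub, inv_neg, inv_neg,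
      neg_mul_neg]
  have h : δ⁻¹ • (ρ g - ρ (α g)) = (⟨_, hmem⟩ : K) • ε • (ρ g - ρ (α g)) := by
    rw [Subfield.smul_def, smul_smul, inv_mul_cancel_right₀ (sub_ne_zero.2 hx.symm)]
  exact h ▸ Submodule.smul_mem _ _
    (D.isAbsIrreducible.character_sub_smul_sub_mem_fixedSpan D.sq_eq_one x g)

theorem eq_zero_of_eq_mul {x y : L} (hx : x ∈ K) (hy : y ∈ K) (h : x = δ * y) : x = 0 := by
  have hc := congrArg c h
  rw [map_mul, (D.mem_iff x).1 hx, (D.mem_iff y).1 hy, hδ, neg_mul, ← h] at hc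
  exact self_eq_neg.1 hc

variable (hδ0 : δ ≠ 0)
include hδ0

theorem exists_eq_add_mul (x : L) : ∃ a b : K, x = a + δ * b := by
  refine ⟨⟨(x + c x) / 2, ?_⟩, ⟨(x - c x) / (2 * δ), ?_⟩, ?_⟩
  · rw [D.mem_iff, map_div₀, map_add, D.involutive, map_ofNat, add_comm]
  · rw [D.mem_iff, map_div₀, map_sub, D.involutive, map_mul, map_ofNat, hδ, mul_neg, div_neg,
      ← neg_div, neg_sub]
  · field_simp
    ring

theorem exists_eq_one_tmul_add_tmul {M : Type*} [AddCommGroup M] [Module K M] (x : L ⊗[K] M) :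
    ∃ a b : M, x = 1 ⊗ₜ[K] a + δ ⊗ₜ[K] b := by
  induction x with
  | zero => exact ⟨0, 0, by simp⟩
  | add x y hx hy =>
    obtain ⟨a, b, rfl⟩ := hx
    obtain ⟨a', b', rfl⟩ := hy
    refine ⟨a + a', b + b', ?_⟩
    rw [TensorProduct.tmul_add, TensorProduct.tmul_add, add_add_add_comm]
  | tmul l a =>
    obtain ⟨p, q, rfl⟩ := D.exists_eq_add_mul hδ hδ0 l
    refine ⟨p • a, q • a, ?_⟩
    rw [← TensorProduct.smul_tmul, ← TensorProduct.smul_tmul, TensorProduct.add_tmul,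
      Subfield.smul_def, Subfield.smul_def, smul_eq_mul, smul_eq_mul, mul_one, mul_comm]

end ConjugateTwist

end ConjugateTwists

section FixedAlgebra

variable {L : Type*} [Field L] [CharZero L] {G V : Type*} [Group G] [AddCommGroup V]
  [Module L V] {K : Subfield L} {ρ : Representation L G V} {α : MulAut G}

instance finiteDimensional_fixedAlgebra [Finite G] (hα : α ^ 2 = 1) :
    FiniteDimensional K (fixedAlgebra K ρ α hα) :=
  FiniteDimensional.span_of_finite K (Set.finite_range fun g => ρ g + ρ (α g))

/-- The multiplication map `L ⊗ A → End_L(V)` for the fixed algebra `A`. -/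
def toEnd (K : Subfield L) (ρ : Representation L G V) {α : MulAut G} (hα : α ^ 2 = 1) :
    (L ⊗[K] fixedAlgebra K ρ α hα) →ₐ[L] Module.End L V :=
  Algebra.TensorProduct.lift (Algebra.ofId L (Module.End L V)) (fixedAlgebra K ρ α hα).val
    fun l _ => by
      rw [Algebra.ofId_apply]
      exact Algebra.commute_algebraMap_left l _

theorem toEnd_tmul (hα : α ^ 2 = 1) (l : L) (a : fixedAlgebra K ρ α hα) :
    toEnd K ρ hα (l ⊗ₜ a) = l • (a : Module.End L V) := by
  rw [toEnd, Algebra.TensorProduct.lift_tmul, Algebra.smul_def]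
  rfl

theorem isUnit_fixedAlgebra_iff [Finite G] [FiniteDimensional L V] {hα : α ^ 2 = 1}
    {a : fixedAlgebra K ρ α hα} : IsUnit a ↔ LinearMap.det (a : Module.End L V) ≠ 0 := by
  refine ⟨fun h => ((h.map (fixedAlgebra K ρ α hα).val).map LinearMap.det).ne_zero, fun h => ?_⟩
  have hunit : IsUnit (a : Module.End L V) := (LinearMap.isUnit_iff_isUnit_det _).2 h.isUnit
  have hinj : Function.Injective (LinearMap.mulLeft K a) := fun x y hxy =>
    Subtype.ext (hunit.mul_left_cancel (congrArg Subtype.val hxy))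
  obtain ⟨b, hab⟩ := LinearMap.surjective_of_injective hinj 1
  have hba : b * a = 1 := hinj (by
    rw [LinearMap.mulLeft_apply, LinearMap.mulLeft_apply, ← mul_assoc, mul_one,
      show a * b = 1 from hab, one_mul])
  exact ⟨⟨a, b, hab, hba⟩, rfl⟩

namespace ConjugateTwist

variable [Fintype G] [FiniteDimensional L V] {c : L →+* L}
  (D : ConjugateTwist K c ρ α)
include D

theorem toEnd_surjective : Function.Surjective (toEnd K ρ D.sq_eq_one) := by
  obtain ⟨δ, hδ0, hδ⟩ := D.exists_conj_eq_neg
  suffices h : LinearMap.range (toEnd K ρ D.sq_eq_one).toLinearMap = ⊤ from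
    LinearMap.range_eq_top.1 h
  refine D.isAbsIrreducible.eq_top_of_forall_mem fun g => ?_
  let a : fixedAlgebra K ρ α D.sq_eq_one := ⟨ρ g + ρ (α g), Submodule.subset_span ⟨g, rfl⟩⟩
  let b : fixedAlgebra K ρ α D.sq_eq_one :=
    ⟨δ⁻¹ • (ρ g - ρ (α g)), D.inv_smul_sub_mem_fixedSpan hδ g⟩
  refine ⟨(2 : L)⁻¹ • (1 ⊗ₜ[K] a + δ ⊗ₜ[K] b), ?_⟩
  rw [AlgHom.toLinearMap_apply, map_smul, map_add, toEnd_tmul, toEnd_tmul, one_smul,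
    smul_inv_smul₀ hδ0, add_add_sub_cancel, ← two_smul L, inv_smul_smul₀ two_ne_zero]

variable {δ : L} (hδ : c δ = -δ) (hδ0 : δ ≠ 0)
include hδ hδ0

theorem exists_eq_add_smul (x : Module.End L V) :
    ∃ a b : fixedAlgebra K ρ α D.sq_eq_one, x = a + δ • (b : Module.End L V) := by
  obtain ⟨y, rfl⟩ := D.toEnd_surjective x
  obtain ⟨a, b, rfl⟩ := D.exists_eq_one_tmul_add_tmul hδ hδ0 y
  exact ⟨a, b, by rw [map_add, toEnd_tmul, toEnd_tmul, one_smul]⟩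

-- If `a = δ b`, the traces of `a a'` and `b a'` lie in `K` for `a' ∈ A`, so `a` is orthogonal to
-- `A` for the trace form, hence to `A + δ A = End_L(V)`.
theorem eq_zero_of_eq_smul {a b : fixedAlgebra K ρ α D.sq_eq_one}
    (h : (a : Module.End L V) = δ • (b : Module.End L V)) : a = 0 := by
  have htrace (a' : fixedAlgebra K ρ α D.sq_eq_one) :
      LinearMap.trace L V ((a : Module.End L V) * a') = 0 :=
    D.eq_zero_of_eq_mul hδ (D.trace_mem (a * a').2) (D.trace_mem (b * a').2) <| by
      rw [h, smul_mul_assoc, map_smul, smul_eq_mul]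
      rfl
  refine Subtype.ext (D.isAbsIrreducible.eq_zero_of_forall_trace_mul fun x => ?_)
  obtain ⟨p, q, rfl⟩ := D.exists_eq_add_smul hδ hδ0 x
  rw [mul_add, map_add, mul_smul_comm, map_smul, htrace, htrace, smul_zero, add_zero]

theorem add_smul_inj {a b a' b' : fixedAlgebra K ρ α D.sq_eq_one}
    (h : (a : Module.End L V) + δ • (b : Module.End L V) = a' + δ • (b' : Module.End L V)) :
    a = a' ∧ b = b' := by
  have hsub : ((a - a' : fixedAlgebra K ρ α D.sq_eq_one) : Module.End L V) =
      δ • ((b' - b : fixedAlgebra K ρ α D.sq_eq_one) : Module.End L V) := by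
    rw [Subalgebra.coe_sub, Subalgebra.coe_sub, smul_sub, sub_eq_sub_iff_add_eq_add, h, add_comm]
  have ha := D.eq_zero_of_eq_smul hδ hδ0 hsub
  rw [ha, eq_comm, ZeroMemClass.coe_zero, smul_eq_zero, or_iff_right hδ0,
    ZeroMemClass.coe_eq_zero] at hsub
  exact ⟨sub_eq_zero.1 ha, (sub_eq_zero.1 hsub).symm⟩

omit hδ hδ0

theorem toEnd_bijective : Function.Bijective (toEnd K ρ D.sq_eq_one) := by
  obtain ⟨δ, hδ0, hδ⟩ := D.exists_conj_eq_neg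
  refine ⟨(injective_iff_map_eq_zero _).2 fun x hx => ?_, D.toEnd_surjective⟩
  obtain ⟨a, b, rfl⟩ := D.exists_eq_one_tmul_add_tmul hδ hδ0 x
  rw [map_add, toEnd_tmul, toEnd_tmul, one_smul] at hx
  obtain ⟨rfl, rfl⟩ : a = 0 ∧ b = 0 := D.add_smul_inj hδ hδ0 (hx.trans (by simp))
  rw [TensorProduct.tmul_zero, TensorProduct.tmul_zero, add_zero]

/-- Extension of scalars to `L` splits the fixed algebra: the identification of `L ⊗ A` with a
matrix algebra given by `toEnd` and the standard basis of `V`. -/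
def splitting : (L ⊗[K] fixedAlgebra K ρ α D.sq_eq_one) ≃ₐ[L]
    Matrix (Fin (Module.finrank L V)) (Fin (Module.finrank L V)) L :=
  (AlgEquiv.ofBijective _ D.toEnd_bijective).trans
    (LinearMap.toMatrixAlgEquiv (Module.finBasis L V))

theorem splitting_one_tmul (a : fixedAlgebra K ρ α D.sq_eq_one) :
    D.splitting (1 ⊗ₜ a) =
      LinearMap.toMatrixAlgEquiv (Module.finBasis L V) (a : Module.End L V) := by
  rw [splitting, AlgEquiv.trans_apply, AlgEquiv.ofBijective_apply, toEnd_tmul, one_smul]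

theorem charpoly_splitting (a : fixedAlgebra K ρ α D.sq_eq_one) :
    (D.splitting (1 ⊗ₜ a)).charpoly = LinearMap.charpoly (a : Module.End L V) :=
  D.splitting_one_tmul a ▸ LinearMap.charpoly_toMatrix _ _

theorem det_splitting (a : fixedAlgebra K ρ α D.sq_eq_one) :
    (D.splitting (1 ⊗ₜ a)).det = LinearMap.det (a : Module.End L V) :=
  D.splitting_one_tmul a ▸ LinearMap.det_toMatrix _ _

theorem exists_map_eq_charpoly (a : fixedAlgebra K ρ α D.sq_eq_one) :
    ∃ q : K[X], q.map (algebraMap K L) = (D.splitting (1 ⊗ₜ a)).charpoly := by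
  have hpow := map_charpoly_mulLeft D.splitting a
  rw [Fintype.card_fin] at hpow
  refine D.map_eq_self_iff.1 (eq_of_monic_of_pow_eq ((Matrix.charpoly_monic _).map _)
    (Matrix.charpoly_monic _) D.isAbsIrreducible.finrank_ne_zero ?_)
  rw [← Polynomial.map_pow, ← hpow, D.map_eq_self_iff]
  exact ⟨_, rfl⟩

end ConjugateTwist

end FixedAlgebra

section ReducedNorms

variable {A : Type*} [Ring A] {n : ℕ}

section

variable {K E : Type*} [Field K] [Field E] [Algebra K E] [Algebra K A]

theorem finrank_eq_sq_of_splitting (f : (E ⊗[K] A) ≃ₐ[E] Matrix (Fin n) (Fin n) E) :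
    Module.finrank K A = n ^ 2 := by
  rw [← Module.finrank_baseChange (R := E), f.toLinearEquiv.finrank_eq, Module.finrank_matrix,
    Fintype.card_fin, Module.finrank_self, mul_one, pow_two]

variable [FiniteDimensional K A] {E₀ : Type*} [Field E₀] [Algebra K E₀]

theorem map_eq_charpoly_of_splitting (f₀ : (E₀ ⊗[K] A) ≃ₐ[E₀] Matrix (Fin n) (Fin n) E₀)
    (f : (E ⊗[K] A) ≃ₐ[E] Matrix (Fin n) (Fin n) E) (hn : n ≠ 0) {a : A} {q : K[X]}
    (hq : q.map (algebraMap K E₀) = (f₀ (1 ⊗ₜ[K] a)).charpoly) :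
    q.map (algebraMap K E) = (f (1 ⊗ₜ[K] a)).charpoly := by
  have hpow : (LinearMap.mulLeft K a).charpoly = q ^ n := by
    refine Polynomial.map_injective _ (algebraMap K E₀).injective ?_
    rw [map_charpoly_mulLeft f₀, ← hq, Polynomial.map_pow, Fintype.card_fin]
  have hmonic : q.Monic := Polynomial.monic_of_injective (algebraMap K E₀).injective
    (hq ▸ Matrix.charpoly_monic _)
  refine eq_of_monic_of_pow_eq (hmonic.map _) (Matrix.charpoly_monic _) hn ?_
  rw [← Polynomial.map_pow, ← hpow, map_charpoly_mulLeft f, Fintype.card_fin]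

end

theorem isReducedNorm_iff_of_splitting {F F₀ : Type} [Field F] [Field F₀] [Algebra F F₀]
    [Algebra F A] [FiniteDimensional F A] (f₀ : (F₀ ⊗[F] A) ≃ₐ[F₀] Matrix (Fin n) (Fin n) F₀)
    (hn : n ≠ 0) {a : A} {q : F[X]} (hq : q.map (algebraMap F F₀) = (f₀ (1 ⊗ₜ[F] a)).charpoly)
    {k : F} : IsReducedNorm a k ↔ algebraMap F F₀ k = (f₀ (1 ⊗ₜ[F] a)).det := by
  refine ⟨?_, fun h => ⟨F₀, inferInstance, inferInstance, n, f₀, h.symm⟩⟩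
  rintro ⟨E, _, _, n', f, hf⟩
  obtain rfl : n' = n := Nat.pow_left_injective two_ne_zero <|
    (finrank_eq_sq_of_splitting f).symm.trans (finrank_eq_sq_of_splitting f₀)
  rw [Matrix.det_eq_sign_charpoly_coeff] at hf ⊢
  rw [← map_eq_charpoly_of_splitting f₀ f hn hq, Polynomial.coeff_map, ← map_one (algebraMap F E),
    ← map_neg, ← map_pow, ← map_mul, (algebraMap F E).injective.eq_iff] at hf
  rw [← hf, ← hq, Polynomial.coeff_map, map_mul, map_pow, map_neg, map_one]

end ReducedNorms

namespace ConjugateTwist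

variable {L : Type} [Field L] [CharZero L] {G V : Type*} [Group G] [Fintype G] [AddCommGroup V]
  [Module L V] [FiniteDimensional L V] {K : Subfield L} {ρ : Representation L G V} {α : MulAut G}
  {c : L →+* L} (D : ConjugateTwist K c ρ α)
include D

theorem isReducedNorm_iff {a : fixedAlgebra K ρ α D.sq_eq_one} {k : K} :
    IsReducedNorm a k ↔ (k : L) = LinearMap.det (a : Module.End L V) := by
  obtain ⟨q, hq⟩ := D.exists_map_eq_charpoly a
  rw [isReducedNorm_iff_of_splitting D.splitting D.isAbsIrreducible.finrank_ne_zero hq,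
    D.det_splitting]
  rfl

theorem exists_isReducedNorm (a : fixedAlgebra K ρ α D.sq_eq_one) : ∃ k : K, IsReducedNorm a k := by
  obtain ⟨q, hq⟩ := D.exists_map_eq_charpoly a
  refine ⟨(-1) ^ Module.finrank L V * q.coeff 0, D.isReducedNorm_iff.2 ?_⟩
  rw [← D.det_splitting, Matrix.det_eq_sign_charpoly_coeff, ← hq, Polynomial.coeff_map,
    Fintype.card_fin]
  push_cast
  rfl

end ConjugateTwist

section Adjoints

open LinearMap

variable {R M : Type*} [CommRing R] [AddCommGroup M] [Module R M]

theorem isAdjointPair_iff_eq {I : R →+* R} {H : M →ₗ[R] M →ₛₗ[I] R} (hH : H.SeparatingRight)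
    {f g g' : Module.End R M} (h : IsAdjointPair H H f g) : IsAdjointPair H H f g' ↔ g = g' := by
  refine ⟨fun h' => LinearMap.ext fun w => sub_eq_zero.1 (hH _ fun v => ?_), fun hg => hg ▸ h⟩
  rw [map_sub, ← h, ← h', sub_self]

variable {n : Type*} [Fintype n] [DecidableEq n] {B : LinearMap.BilinForm R M}

open scoped Matrix in
theorem isSkewAdjoint_iff_transpose_toMatrix (b : Module.Basis n R M) (hB : B.IsSymm)
    {a : Module.End R M} : B.IsSkewAdjoint a ↔
      (LinearMap.BilinForm.toMatrix b B * toMatrix b b a)ᵀ =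
        -(LinearMap.BilinForm.toMatrix b B * toMatrix b b a) := by
  rw [Matrix.transpose_mul, ((LinearMap.BilinForm.isSymm_toMatrix_iff_isSymm b).2 hB).eq,
    ← LinearMap.BilinForm.toMatrix_compLeft, ← LinearMap.BilinForm.toMatrix_compRight, ← map_neg,
    EmbeddingLike.apply_eq_iff_eq, LinearMap.ext_iff₂]
  refine forall₂_congr fun v w => ?_
  rw [Pi.neg_apply, map_neg]
  rfl

theorem isSquare_det_toMatrix_mul_det [IsDomain R] [IsIntegrallyClosed R] [NeZero (2 : R)]
    (b : Module.Basis n R M) (hB : B.IsSymm) {a : Module.End R M} (ha : B.IsSkewAdjoint a) :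
    IsSquare ((LinearMap.BilinForm.toMatrix b B).det * LinearMap.det a) := by
  rw [← det_toMatrix b, ← Matrix.det_mul]
  exact isSquare_det_of_skew ((isSkewAdjoint_iff_transpose_toMatrix b hB).1 ha)

end Adjoints

section SkewAdjoints

open LinearMap

variable {F V : Type*} [Field F] [AddCommGroup V] [Module F V]

open scoped Matrix in
theorem exists_skew_matrix (F : Type*) [Field F] {n : ℕ} (hn : Even n) :
    ∃ J : Matrix (Fin n) (Fin n) F, Jᵀ = -J ∧ J.det ≠ 0 := by
  obtain ⟨m, rfl⟩ := hn
  refine ⟨Matrix.reindex finSumFinEquiv finSumFinEquiv (Matrix.J (Fin m) F), ?_, ?_⟩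
  · rw [Matrix.transpose_reindex, Matrix.J_transpose]
    rfl
  · rw [Matrix.det_reindex_self]
    exact (Matrix.isUnit_det_J _ _).ne_zero

theorem exists_nat_det_add_smul_ne_zero [CharZero F] [FiniteDimensional F V]
    {f g : Module.End F V} {t : F} (h : LinearMap.det (f + t • g) ≠ 0) :
    ∃ k : ℕ, LinearMap.det (f + (k : F) • g) ≠ 0 := by
  let b := Module.finBasis F V
  let P : F[X] := ((toMatrix b b f).map Polynomial.C +
    (Polynomial.X : F[X]) • (toMatrix b b g).map Polynomial.C).det
  have heval (x : F) : P.eval x = LinearMap.det (f + x • g) := by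
    rw [← det_toMatrix b, ← Polynomial.coe_evalRingHom, RingHom.map_det]
    congr 1
    ext i j
    simpa using mul_comm _ _
  by_contra! hk
  have hroots : Set.range (Nat.cast : ℕ → F) ⊆ {x | P.IsRoot x} :=
    Set.range_subset_iff.2 fun k => (heval k).trans (hk k)
  have hP : P = 0 := Polynomial.eq_zero_of_infinite_isRoot _
    ((Set.infinite_range_of_injective Nat.cast_injective).mono hroots)
  exact h (by rw [← heval, hP, Polynomial.eval_zero])

variable [FiniteDimensional F V] {B : LinearMap.BilinForm F V}

theorem exists_isSkewAdjoint_det_ne_zero (hB : B.IsSymm) (hB' : B.Nondegenerate)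
    (heven : Even (Module.finrank F V)) :
    ∃ x : Module.End F V, B.IsSkewAdjoint x ∧ LinearMap.det x ≠ 0 := by
  let b := Module.finBasis F V
  have hS := (LinearMap.BilinForm.nondegenerate_iff_det_ne_zero b).1 hB'
  obtain ⟨J, hJ, hJ'⟩ := exists_skew_matrix F heven
  refine ⟨Matrix.toLin b b ((LinearMap.BilinForm.toMatrix b B)⁻¹ * J), ?_, ?_⟩
  · rw [isSkewAdjoint_iff_transpose_toMatrix b hB, toMatrix_toLin,
      Matrix.mul_nonsing_inv_cancel_left _ _ hS.isUnit, hJ]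
  · rw [LinearMap.det_toLin, Matrix.det_mul, Matrix.det_nonsing_inv, Ring.inverse_eq_inv']
    exact mul_ne_zero (inv_ne_zero hS) hJ'

theorem exists_monic_sq_eq_charpoly_of_isSkewAdjoint [NeZero (2 : F)] (hB : B.IsSymm)
    (hB' : B.Nondegenerate) {a x : Module.End F V} (ha : B.IsSkewAdjoint a)
    (hax : B.IsSkewAdjoint (a * x)) (ha0 : LinearMap.det a ≠ 0) :
    ∃ p : F[X], p.Monic ∧ p ^ 2 = x.charpoly := by
  let b := Module.finBasis F V
  set S := LinearMap.BilinForm.toMatrix b B * toMatrix b b a with hS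
  have hunit : IsUnit S.det := by
    rw [Matrix.det_mul, det_toMatrix]
    exact (mul_ne_zero ((LinearMap.BilinForm.nondegenerate_iff_det_ne_zero b).1 hB') ha0).isUnit
  have hx : S⁻¹ * (LinearMap.BilinForm.toMatrix b B * toMatrix b b (a * x)) = toMatrix b b x := by
    rw [toMatrix_mul, ← Matrix.mul_assoc (LinearMap.BilinForm.toMatrix b B), ← hS,
      Matrix.nonsing_inv_mul_cancel_left _ _ hunit]
  rw [← charpoly_toMatrix x b, ← hx]
  exact exists_monic_sq_eq_charpoly_of_skew ((isSkewAdjoint_iff_transpose_toMatrix b hB).1 ha)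
    ((isSkewAdjoint_iff_transpose_toMatrix b hB).1 hax) hunit

end SkewAdjoints

section FixedAlgebraAdjoints

open LinearMap

variable {L : Type*} [Field L] {G V : Type*} [Group G] [AddCommGroup V] [Module L V]
  {K : Subfield L} {ρ : Representation L G V} {α : MulAut G} {B : LinearMap.BilinForm L V}

theorem isAdjointPair_add_of_invariant {I : L →+* L} {H : V →ₗ[L] V →ₛₗ[I] L}
    (hH : ∀ g v w, H (ρ g v) (ρ g w) = H v w) (g : G) :
    IsAdjointPair H H (ρ g + ρ (α g)) (ρ g⁻¹ + ρ (α g⁻¹)) := by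
  have hadj (g : G) : IsAdjointPair H H (ρ g) (ρ g⁻¹) := fun v w => by
    rw [← hH g v, ← Module.End.mul_apply, ← map_mul, mul_inv_cancel, map_one,
      Module.End.one_apply]
  rw [map_inv α]
  exact (hadj g).add (hadj (α g))

theorem TwistedInvariant.isAdjointPair_add (hB : TwistedInvariant ρ α B) (hα : α ^ 2 = 1) (g : G) :
    IsAdjointPair B B (ρ g + ρ (α g)) (ρ g⁻¹ + ρ (α g⁻¹)) := by
  have hadj (g : G) : IsAdjointPair B B (ρ g) (ρ (α g⁻¹)) := fun v w => by
    rw [hB.apply_right, inv_inv]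
  have h := (hadj g).add (hadj (α g))
  rwa [← map_inv α, apply_apply_of_sq_eq_one hα, add_comm (ρ (α g⁻¹) : V → V)] at h

variable [CharZero L]

-- The adjoint on the generators of the fixed algebra does not depend on the form.
theorem exists_forall_isAdjointPair (hα : α ^ 2 = 1) (a : fixedAlgebra K ρ α hα) :
    ∃ a' : fixedAlgebra K ρ α hα, ∀ (I : L →+* L) (H : V →ₗ[L] V →ₛₗ[I] L),
      (∀ k ∈ K, I k = k) →
      (∀ g, IsAdjointPair H H (ρ g + ρ (α g)) (ρ g⁻¹ + ρ (α g⁻¹))) →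
      IsAdjointPair H H (a : Module.End L V) (a' : Module.End L V) := by
  obtain ⟨a, ha⟩ := a
  induction ha using Submodule.span_induction with
  | zero => exact ⟨0, fun I H _ _ => isAdjointPair_zero⟩
  | mem a ha =>
    obtain ⟨g, rfl⟩ := ha
    exact ⟨⟨ρ g⁻¹ + ρ (α g⁻¹), Submodule.subset_span ⟨g⁻¹, rfl⟩⟩, fun I H _ hgen => hgen g⟩
  | add a b _ _ ha hb =>
    obtain ⟨a', ha'⟩ := ha
    obtain ⟨b', hb'⟩ := hb
    exact ⟨a' + b', fun I H hI hgen => (ha' I H hI hgen).add (hb' I H hI hgen)⟩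
  | smul k a _ ha =>
    obtain ⟨a', ha'⟩ := ha
    refine ⟨k • a', fun I H hI hgen v w => ?_⟩
    have h := ha' I H hI hgen v w
    change H ((k : L) • a v) w = H v ((k : L) • (a' : Module.End L V) w)
    rw [map_smul, map_smulₛₗ, hI k k.2, LinearMap.smul_apply, h]

theorem TwistedInvariant.isSkew_iff_isSkewAdjoint (hB : TwistedInvariant ρ α B)
    (hB' : B.Nondegenerate) {hα : α ^ 2 = 1} {I : L →+* L} (hI : ∀ k ∈ K, I k = k)
    {H : V →ₗ[L] V →ₛₗ[I] L} (hH : ∀ g v w, H (ρ g v) (ρ g w) = H v w)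
    (hH' : H.SeparatingRight) {a : fixedAlgebra K ρ α hα} :
    IsSkew (H · ·) (a : Module.End L V) ↔ B.IsSkewAdjoint (a : Module.End L V) := by
  obtain ⟨a', ha'⟩ := exists_forall_isAdjointPair hα a
  exact (isAdjointPair_iff_eq hH' (g' := -(a : Module.End L V))
      (ha' I H hI (isAdjointPair_add_of_invariant hH))).trans
    (isAdjointPair_iff_eq hB'.2
      (ha' (RingHom.id L) B (fun _ _ => rfl) (hB.isAdjointPair_add hα))).symm

namespace ConjugateTwist

variable [Fintype G] [FiniteDimensional L V] {c : L →+* L} (D : ConjugateTwist K c ρ α)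
include D

theorem isSkewAdjoint_of_add_smul (hB : TwistedInvariant ρ α B) (hB' : B.Nondegenerate) {δ : L}
    (hδ : c δ = -δ) (hδ0 : δ ≠ 0) {a b : fixedAlgebra K ρ α D.sq_eq_one}
    (h : B.IsSkewAdjoint (a + δ • (b : Module.End L V) : Module.End L V)) :
    B.IsSkewAdjoint (a : Module.End L V) ∧ B.IsSkewAdjoint (b : Module.End L V) := by
  have hadj (a : fixedAlgebra K ρ α D.sq_eq_one) : ∃ a' : fixedAlgebra K ρ α D.sq_eq_one,
      IsAdjointPair B B (a : Module.End L V) (a' : Module.End L V) :=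
    (exists_forall_isAdjointPair D.sq_eq_one a).imp fun a' ha' =>
      ha' _ B (fun _ _ => rfl) (hB.isAdjointPair_add D.sq_eq_one)
  obtain ⟨a', ha'⟩ := hadj a
  obtain ⟨b', hb'⟩ := hadj b
  have hsum : (a' + δ • (b' : Module.End L V) : Module.End L V) =
      -(a + δ • (b : Module.End L V)) :=
    (isAdjointPair_iff_eq hB'.2 (ha'.add (hb'.smul δ))).1 h
  rw [neg_add, ← smul_neg] at hsum
  obtain ⟨rfl, rfl⟩ := D.add_smul_inj hδ hδ0 (a' := -a) (b' := -b) hsum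
  exact ⟨ha', hb'⟩

theorem exists_isSkewAdjoint_det_ne_zero (hB : TwistedInvariant ρ α B) (hB' : B.Nondegenerate)
    (hsymm : B.IsSymm) (heven : Even (Module.finrank L V)) :
    ∃ a : fixedAlgebra K ρ α D.sq_eq_one, B.IsSkewAdjoint (a : Module.End L V) ∧
      LinearMap.det (a : Module.End L V) ≠ 0 := by
  obtain ⟨δ, hδ0, hδ⟩ := D.exists_conj_eq_neg
  obtain ⟨x, hx, hx0⟩ := AlphaDisc.exists_isSkewAdjoint_det_ne_zero hsymm hB' heven
  obtain ⟨a, b, rfl⟩ := D.exists_eq_add_smul hδ hδ0 x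
  obtain ⟨ha, hb⟩ := D.isSkewAdjoint_of_add_smul hB hB' hδ hδ0 hx
  obtain ⟨k, hk⟩ := exists_nat_det_add_smul_ne_zero hx0
  have hskew := ha.add (hb.smul (k : L))
  rw [smul_neg, ← neg_add] at hskew
  exact ⟨a + (k : K) • b, hskew, hk⟩

theorem exists_map_eq_of_sq_eq_charpoly {x : fixedAlgebra K ρ α D.sq_eq_one} {p : L[X]}
    (hp : p.Monic) (h : p ^ 2 = LinearMap.charpoly (x : Module.End L V)) :
    ∃ q : K[X], q.map (algebraMap K L) = p := by
  obtain ⟨r, hr⟩ := D.exists_map_eq_charpoly x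
  refine D.map_eq_self_iff.1 (eq_of_monic_of_pow_eq (hp.map _) hp two_ne_zero ?_)
  rw [← Polynomial.map_pow, h, ← D.charpoly_splitting, D.map_eq_self_iff]
  exact ⟨r, hr⟩

theorem exists_det_eq_mul_sq (hB : B.Nondegenerate) (hsymm : B.IsSymm)
    (heven : Even (Module.finrank L V)) {a b : fixedAlgebra K ρ α D.sq_eq_one}
    (ha : B.IsSkewAdjoint (a : Module.End L V)) (hb : B.IsSkewAdjoint (b : Module.End L V))
    (ha0 : LinearMap.det (a : Module.End L V) ≠ 0) :
    ∃ s : K, LinearMap.det (b : Module.End L V) =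
      LinearMap.det (a : Module.End L V) * (s : L) ^ 2 := by
  obtain ⟨x, rfl⟩ : ∃ x, b = a * x := (isUnit_fixedAlgebra_iff.2 ha0).dvd
  obtain ⟨p, hp, hpx⟩ :=
    exists_monic_sq_eq_charpoly_of_isSkewAdjoint hsymm hB (x := x) ha hb ha0
  obtain ⟨q, rfl⟩ := D.exists_map_eq_of_sq_eq_charpoly hp hpx
  refine ⟨q.coeff 0, ?_⟩
  rw [MulMemClass.coe_mul, map_mul, LinearMap.det_eq_sign_charpoly_coeff (x : Module.End L V),
    ← hpx, heven.neg_one_pow, one_mul, sq (Polynomial.map _ _), Polynomial.mul_coeff_zero,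
    Polynomial.coeff_map, sq]
  rfl

end ConjugateTwist

end FixedAlgebraAdjoints

section Discriminant

namespace ConjugateTwist

variable {L : Type} [Field L] [CharZero L] {G V : Type*} [Group G] [Fintype G] [AddCommGroup V]
  [Module L V] [FiniteDimensional L V] {K : Subfield L} {c : L →+* L} {ρ : Representation L G V}
  {α : MulAut G} (D : ConjugateTwist K c ρ α) {B : LinearMap.BilinForm L V} {m : ℕ} {d : Kˣ}
include D

theorem mem_discClass_iff (hm : Module.finrank L V = 2 * m)
    {S : Set (fixedAlgebra K ρ α D.sq_eq_one)} :
    d ∈ discClass K S ↔ ∃ a ∈ S, ∃ s : Kˣ, LinearMap.det (a : Module.End L V) ≠ 0 ∧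
      ((d : K) : L) = (-1) ^ m * LinearMap.det (a : Module.End L V) * ((s : K) : L) ^ 2 := by
  have hA : Module.finrank K (fixedAlgebra K ρ α D.sq_eq_one) = (2 * m) ^ 2 :=
    hm ▸ finrank_eq_sq_of_splitting D.splitting
  constructor
  · rintro ⟨m', a, k, s, hm', ha, hunit, hk, hd⟩
    obtain rfl : m' = m := mul_left_cancel₀ two_ne_zero
      (Nat.pow_left_injective two_ne_zero (hm'.symm.trans hA))
    refine ⟨a, ha, s, isUnit_fixedAlgebra_iff.1 hunit, ?_⟩
    rw [hd, ← D.isReducedNorm_iff.1 hk]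
    push_cast
    rfl
  · rintro ⟨a, ha, s, ha0, hd⟩
    obtain ⟨k, hk⟩ := D.exists_isReducedNorm a
    refine ⟨m, a, k, s, hA, ha, isUnit_fixedAlgebra_iff.2 ha0, hk, Subtype.ext ?_⟩
    rw [hd, ← D.isReducedNorm_iff.1 hk]
    push_cast
    rfl

theorem exists_discClass_eq (hB : TwistedInvariant ρ α B) (hB' : B.Nondegenerate)
    (hsymm : B.IsSymm) (hm : Module.finrank L V = 2 * m) :
    ∃ d₀ : Kˣ, discClass K {a : fixedAlgebra K ρ α D.sq_eq_one |
      B.IsSkewAdjoint (a : Module.End L V)} = {d | ∃ s : Kˣ, d = d₀ * s ^ 2} := by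
  have heven : Even (Module.finrank L V) := hm ▸ even_two_mul m
  obtain ⟨a, ha, ha0⟩ := D.exists_isSkewAdjoint_det_ne_zero hB hB' hsymm heven
  obtain ⟨k, hk⟩ := D.exists_isReducedNorm a
  rw [D.isReducedNorm_iff] at hk
  have hk0 : k ≠ 0 := by
    rintro rfl
    exact ha0 hk.symm
  refine ⟨(-1) ^ m * Units.mk0 k hk0, Set.ext fun d => (D.mem_discClass_iff hm).trans ⟨?_, ?_⟩⟩
  · rintro ⟨b, hb, s, hb0, hd⟩
    obtain ⟨r, hr⟩ := D.exists_det_eq_mul_sq hB' hsymm heven ha hb ha0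
    have hr0 : r ≠ 0 := by
      rintro rfl
      exact hb0 (by rw [hr, ZeroMemClass.coe_zero, zero_pow two_ne_zero, mul_zero])
    refine ⟨Units.mk0 r hr0 * s, Units.ext (Subtype.ext ?_)⟩
    rw [hd, hr, ← hk]
    push_cast [Units.val_mk0]
    ring
  · rintro ⟨s, rfl⟩
    refine ⟨a, ha, s, ha0, ?_⟩
    rw [← hk]
    push_cast [Units.val_mk0]
    rfl

-- `det B * det a` is a square for `a` skew-adjoint, so the discriminant is `± det B` up to squares.
theorem isSquare_valuation_of_mem_discClass (hB : TwistedInvariant ρ α B) (hB' : B.Nondegenerate)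
    (hsymm : B.IsSymm) (hm : Module.finrank L V = 2 * m) {Γ₀ : Type*}
    [LinearOrderedCommGroupWithZero Γ₀] (val : Valuation L Γ₀)
    [IsPrincipalIdealRing val.valuationSubring] (hval : val (Nat.card G : L) = 1)
    (hd : d ∈ discClass K {a : fixedAlgebra K ρ α D.sq_eq_one |
      B.IsSkewAdjoint (a : Module.End L V)}) :
    IsSquare (val ((d : K) : L)) := by
  obtain ⟨a, ha, s, -, hda⟩ := (D.mem_discClass_iff hm).1 hd
  have : Nontrivial V :=
    Module.nontrivial_of_finrank_pos (Nat.pos_of_ne_zero D.isAbsIrreducible.finrank_ne_zero)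
  obtain ⟨b, hb⟩ := hB.exists_isSquare_valuation_det D.isAbsIrreducible hB'.ne_zero val hval
    (hm ▸ even_two_mul m)
  have hS := (Valuation.ne_zero_iff val).2
    ((LinearMap.BilinForm.nondegenerate_iff_det_ne_zero b).1 hB')
  have hprod := (isSquare_det_toMatrix_mul_det b hsymm ha).map val
  rw [map_mul] at hprod
  have hdet : IsSquare (val (LinearMap.det (a : Module.End L V))) := by
    rw [← mul_div_cancel_left₀ (val (LinearMap.det (a : Module.End L V))) hS]
    exact hprod.div hb
  rw [hda, map_mul, map_mul, map_pow, map_pow, Valuation.map_neg, map_one, one_pow, one_mul]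
  exact hdet.mul (IsSquare.sq _)

end ConjugateTwist

end Discriminant

section CharacterField

variable {G : Type*} [Group G] {χ : G → ℂ} {α : MulAut G}

theorem conj_mem_charField (hχα : ∀ g, χ (α g) = conj (χ g)) (x : charField χ) :
    conj (x : ℂ) ∈ charField χ := by
  have h : charField χ ≤ (charField χ).comap (starRingEnd ℂ).toRatAlgHom := by
    rw [IntermediateField.adjoin_le_iff]
    rintro _ ⟨g, rfl⟩
    exact IntermediateField.subset_adjoin ℚ _ ⟨α g, hχα g⟩
  exact h x.2

/-- Complex conjugation on the character field. -/
def charConj (hχα : ∀ g, χ (α g) = conj (χ g)) : charField χ →+* charField χ :=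
  ((starRingEnd ℂ).comp (algebraMap (charField χ) ℂ)).codRestrict (charField χ)
    (conj_mem_charField hχα)

theorem coe_charConj (hχα : ∀ g, χ (α g) = conj (χ g)) (x : charField χ) :
    (charConj hχα x : ℂ) = conj (x : ℂ) := rfl

theorem mem_realField_iff (hχα : ∀ g, χ (α g) = conj (χ g)) {x : charField χ} :
    x ∈ realField χ ↔ charConj hχα x = x := by
  rw [Subtype.ext_iff, coe_charConj, Complex.conj_eq_iff_real]
  exact exists_congr fun r => eq_comm

end CharacterField

section HermitianForms

variable {G V : Type*} [Group G] {χ : G → ℂ} {α : MulAut G} [AddCommGroup V]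
  [Module (charField χ) V] {ρ : Representation (charField χ) G V} {H : V → V → charField χ}
  (hH : IsInvariantHermitian ρ H) (hχα : ∀ g, χ (α g) = conj (χ g))
include hH

theorem IsInvariantHermitian.charConj_apply (v w : V) : charConj hχα (H v w) = H w v :=
  Subtype.ext (hH.conj_symm w v).symm

/-- An invariant Hermitian form on a module over the character field, bundled as a sesquilinear
map. -/
def IsInvariantHermitian.toSesqForm :
    V →ₗ[charField χ] V →ₛₗ[charConj hχα] charField χ :=
  LinearMap.mk₂'ₛₗ (RingHom.id _) (charConj hχα) H hH.add_left hH.smul_left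
    (fun v w w' => by
      rw [← hH.charConj_apply hχα, hH.add_left, map_add, hH.charConj_apply, hH.charConj_apply])
    (fun a v w => by
      rw [← hH.charConj_apply hχα, hH.smul_left, map_mul, hH.charConj_apply, smul_eq_mul])

theorem IsInvariantHermitian.separatingRight_toSesqForm :
    (hH.toSesqForm hχα).SeparatingRight := fun v hv =>
  hH.nondegenerate v fun w => (charConj hχα).injective <| by
    rw [hH.charConj_apply, map_zero]
    exact hv w

include hχα in
theorem alphaDisc_eq_discClass_isSkewAdjoint {B : LinearMap.BilinForm (charField χ) V}
    (hB : TwistedInvariant ρ α B) (hB' : B.Nondegenerate) (hα : α ^ 2 = 1) :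
    alphaDisc χ ρ H α hα = discClass (realField χ)
      {a : fixedAlgebra (realField χ) ρ α hα |
        B.IsSkewAdjoint (a : Module.End (charField χ) V)} := by
  refine congrArg (discClass (realField χ)) (Set.ext fun a => ?_)
  exact hB.isSkew_iff_isSkewAdjoint hB' (H := hH.toSesqForm hχα)
    (fun k hk => (mem_realField_iff hχα).1 hk) hH.invariant
    (hH.separatingRight_toSesqForm hχα)

end HermitianForms

section AffordingRepresentations

variable {G V : Type*} [Group G] {χ : G → ℂ} {α : MulAut G} [AddCommGroup V]
  [Module (charField χ) V] {ρ : Representation (charField χ) G V}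
  (hρ : ∀ g, ((ρ.character g : charField χ) : ℂ) = χ g)
include hρ

theorem finrank_eq_of_apply_one_eq {n : ℕ} (hn : χ 1 = n) [FiniteDimensional (charField χ) V] :
    Module.finrank (charField χ) V = n := by
  have h : ((Module.finrank (charField χ) V : charField χ) : ℂ) = n := by
    rw [← Representation.char_one ρ, hρ, hn]
  exact_mod_cast h

variable [Fintype G]

theorem IsIrrChar.isAbsIrreducible (hχ : IsIrrChar χ) : IsAbsIrreducible ρ := by
  refine Subtype.ext ?_
  have h := hχ.sum_mul_inv
  simp only [← hρ] at h
  exact_mod_cast h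

theorem IsIrrChar.conjugateTwist (hχ : IsIrrChar χ) (hχO : IndicatorO χ) (hα : α ^ 2 = 1)
    (hχα : ∀ g, χ (α g) = conj (χ g)) :
    ConjugateTwist (realField χ) (charConj hχα) ρ α where
  mem_iff _ := mem_realField_iff hχα
  involutive x := Subtype.ext (Complex.conj_conj _)
  isAbsIrreducible := hχ.isAbsIrreducible hρ
  sq_eq_one := hα
  conj_character g := Subtype.ext (by rw [coe_charConj, hρ, hρ, hχα])
  exists_character_ne := by
    obtain ⟨g, hg⟩ := hχ.exists_apply_ne hχO hχα
    exact ⟨g, fun h => hg (by rw [← hρ, ← hρ, h])⟩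

theorem IsIrrChar.exists_symm_twistedInvariant [FiniteDimensional (charField χ) V]
    (hχ : IsIrrChar χ) (hα : α ^ 2 = 1) (hχα : ∀ g, χ (α g) = conj (χ g))
    (hsum : ∑ g, χ (g * α g) = Nat.card G) :
    ∃ B : LinearMap.BilinForm (charField χ) V,
      TwistedInvariant ρ α B ∧ B.Nondegenerate ∧ B.IsSymm := by
  have habs := hχ.isAbsIrreducible hρ
  have htwist (g : G) : ρ.character (α g) = ρ.character g⁻¹ :=
    Subtype.ext (by rw [hρ, hρ, hχα, hχ.apply_inv])
  have hsum' : ∑ g, ρ.character g * ρ.character (α g) ≠ 0 := by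
    simp only [htwist]
    exact habs.trans_ne (Nat.cast_ne_zero.2 Nat.card_pos.ne')
  obtain ⟨B, hB0, hB⟩ := exists_twistedInvariant hsum'
  obtain ⟨ε, -, hε⟩ := hB.exists_flip_eq_smul habs hB0 hα
  have hε1 : ε = 1 := by
    have hcard : ∑ g, ρ.character (g * α g) = (Nat.card G : charField χ) := by
      simp only [← hρ] at hsum
      exact_mod_cast hsum
    rw [hB.sum_character_mul_twist habs hB0 hε] at hcard
    exact (mul_eq_right₀ (Nat.cast_ne_zero.2 Nat.card_pos.ne')).1 hcard
  rw [hε1, one_smul] at hε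
  exact ⟨B, hB, hB.nondegenerate habs hB0, LinearMap.BilinForm.isSymm_iff_flip.2 hε⟩

end AffordingRepresentations

theorem valuation_natCast_eq_one {K : Type*} [Field K] [NumberField K]
    {v : IsDedekindDomain.HeightOneSpectrum (NumberField.RingOfIntegers K)} {n : ℕ}
    (hn : (n : NumberField.RingOfIntegers K) ∉ v.asIdeal) : v.valuation K (n : K) = 1 := by
  rw [← map_natCast (algebraMap (NumberField.RingOfIntegers K) K), v.valuation_of_algebraMap]
  exact v.intValuation_eq_one_iff.2 hn

end AlphaDisc

end

theorem mainTheorem6 {G : Type*} [Group G] [Finite G] (χ : G → ℂ)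
    (hχ : AlphaDisc.IsIrrChar χ) (hχo : AlphaDisc.IndicatorO χ) (hχ2 : ∃ m : ℕ, χ 1 = 2 * m)
    {V : Type*} [AddCommGroup V] [Module (AlphaDisc.charField χ) V]
    [FiniteDimensional (AlphaDisc.charField χ) V]
    (ρ : Representation (AlphaDisc.charField χ) G V)
    (hρ : ∀ g, ((ρ.character g : AlphaDisc.charField χ) : ℂ) = χ g)
    (H : V → V → AlphaDisc.charField χ) (hH : AlphaDisc.IsInvariantHermitian ρ H)
    (α : MulAut G) (hα : α ^ 2 = 1) (hχα : ∀ g, χ (α g) = (starRingEnd ℂ) (χ g))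
    (hplus : AlphaDisc.IndicatorPlus (AlphaDisc.inducedChar χ α)) :
    (∃ d₀ : (AlphaDisc.realField χ)ˣ,
      AlphaDisc.alphaDisc χ ρ H α hα = {d | ∃ s : (AlphaDisc.realField χ)ˣ, d = d₀ * s ^ 2}) ∧
    ∀ d ∈ AlphaDisc.alphaDisc χ ρ H α hα,
      ∀ v : IsDedekindDomain.HeightOneSpectrum
          (NumberField.RingOfIntegers (AlphaDisc.realField χ)),
        AlphaDisc.RamifiesIn v (AlphaDisc.quadAlgebra (d : AlphaDisc.realField χ)) →
        v.asIdeal ∣ Ideal.span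
          {(2 * Nat.card G : NumberField.RingOfIntegers (AlphaDisc.realField χ))} := by
  have := Fintype.ofFinite G
  have D := hχ.conjugateTwist hρ hχo hα hχα
  obtain ⟨B, hB, hB', hsymm⟩ := hχ.exists_symm_twistedInvariant hρ hα hχα
    (AlphaDisc.sum_apply_mul_twist_of_indicatorPlus hχ hχo hα hχα hplus)
  obtain ⟨m, hm⟩ := hχ2
  have hdim : Module.finrank (AlphaDisc.charField χ) V = 2 * m :=
    AlphaDisc.finrank_eq_of_apply_one_eq hρ (by exact_mod_cast hm)
  rw [AlphaDisc.alphaDisc_eq_discClass_isSkewAdjoint hH hχα hB hB' hα]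
  refine ⟨D.exists_discClass_eq hB hB' hsymm hdim, fun d hd v hram => ?_⟩
  have := hχ.numberField_charField
  have := hχ.numberField_realField
  rw [Ideal.dvd_span_singleton]
  by_contra hv
  have h2 := fun h => hv (Ideal.mul_mem_right _ _ h)
  have hN := fun h => hv (Ideal.mul_mem_left _ _ h)
  obtain ⟨w, hw⟩ := hχ.exists_valuation_extending v hN
  have hval : w.valuation (AlphaDisc.charField χ) (Nat.card G : AlphaDisc.charField χ) = 1 :=
    (hw (Nat.card G)).trans (AlphaDisc.valuation_natCast_eq_one hN)
  have hsq := D.isSquare_valuation_of_mem_discClass hB hB' hsymm hdim _ hval hd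
  rw [hw] at hsq
  exact AlphaDisc.not_ramifiesIn_of_isSquare_valuation v d.ne_zero h2 hsq hram
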